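/- Let $S$ be a finite set of simple steps $(1,u)$, $u\in\mathbb Z$, and let $\Gamma(y)=\sum_{(1,u)\in S}y^u$. A walk of length $n$ with step set $S$ is a sequence of points $A_0=(0,0),A_1,\dots,A_n$ of $\mathbb Z^2$ whose successive differences all lie in $S$; its final altitude is the second coordinate of $A_n$. A meander is a walk all of whose points have nonnegative second coordinate. Let $w_{n,k}$ be the number of walks of length $n$ and final altitude $k$, let $W(x,y)=\sum_{n\ge 0,\,k\in\mathbb Z}w_{n,k}x^ny^k\in\mathbb Z[y,y^{-1}][[x]]$, and let $M(x)=\sum_{n\ge0}m_nx^n$, where $m_n$ is the number of meanders of length $n$. Put $$A(x)=[y^0]\,\frac{y}{1-y}\,W(x,y)\in\mathbb Q[[x]],$$ where the product is taken in $\mathbb Q((y))[[x]]$, with $\frac{y}{1-y}=\sum_{k\ge1}y^k$, and $[y^0]$ is applied to each coefficient in $x$. Then $A(0)=0$ and $$M(x)=\frac{\exp\left(-\int\frac{A(x)}{x}\,\mathrm dx\right)}{1-x\Gamma(1)},\qquad\text{equivalently}\qquad \log M(x)=-\log(1-x\Gamma(1))-\int\frac{A(x)}{x}\,\mathrm dx,$$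 where $\int$ denotes the formal antiderivative with zero constant term. Moreover $A(x)$ is a sum of residues of a rational function of $y$: $$A(x)=\sum_{i}\operatorname{Residue}_{y=y_i(x)}\left(\frac{1}{(1-y)(1-x\Gamma(y))}\right),$$ where the $y_i(x)$ are the small branches of $y^{u^-}-xy^{u^-}\Gamma(y)$, that is, its distinct roots of positive valuation in the field of Puiseux series in $x$ over an algebraically closed field $K$ of characteristic $0$ (for instance $K=\mathbb C$), and $u^-\ge0$ is the largest integer $u$ such that $(1,-u)\in S$ (and $u^-=0$ if no step of $S$ has negative height). -/

import Mathlib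

/-! Unidimensional lattice walks. A simple step `(1, u)` is recorded by its height `u`, so that a step
set is a finite set of integers. -/

noncomputable section

namespace LatticeWalk

/-- `A` is a walk of length `n` with step set `S`: a sequence `A₀, …, Aₙ` of points of `ℤ²`, starting
at the origin, such that every difference `Aₖ₊₁ - Aₖ` is a simple step `(1, u)` with `u ∈ S`. -/
def IsWalk (S : Finset ℤ) (n : ℕ) (A : Fin (n + 1) → ℤ × ℤ) : Prop :=
  A 0 = (0, 0) ∧ ∀ k : Fin n, ∃ u ∈ S, A k.succ - A k.castSucc = (1, u)

/-- The final altitude of a walk. -/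
def finalAltitude {n : ℕ} (A : Fin (n + 1) → ℤ × ℤ) : ℤ := (A (Fin.last n)).2

/-- A meander is a walk confined to the upper half plane. -/
def IsMeander (S : Finset ℤ) (n : ℕ) (A : Fin (n + 1) → ℤ × ℤ) : Prop :=
  IsWalk S n A ∧ ∀ i, 0 ≤ (A i).2

/-- There are finitely many walks of length `n`, so the cardinalities below are meaningful. -/
theorem finite_walks (S : Finset ℤ) (n : ℕ) : {A | IsWalk S n A}.Finite := by
  refine Set.Finite.of_injOn (f := fun A (k : Fin n) => A k.succ - A k.castSucc)
    (t := Set.pi Set.univ fun _ => (fun u : ℤ => ((1 : ℤ), u)) '' (S : Set ℤ)) ?_ ?_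
    (Set.Finite.pi fun _ => (Finset.finite_toSet S).image _)
  · intro A hA k _
    obtain ⟨u, hu, h⟩ := hA.2 k
    exact ⟨u, hu, h.symm⟩
  · intro A hA B hB h
    funext i
    induction i using Fin.induction with
    | zero => rw [hA.1, hB.1]
    | succ k ih =>
      have hk := congrFun h k
      simp only [ih] at hk
      exact sub_left_injective hk

/-- The number `w_{n,k}` of walks with step set `S`, length `n` and final altitude `k`. -/
def walkCount (S : Finset ℤ) (n : ℕ) (k : ℤ) : ℕ :=
  {A | IsWalk S n A ∧ finalAltitude A = k}.ncard

/-- The number of meanders with step set `S` and length `n`. -/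
def meanderCount (S : Finset ℤ) (n : ℕ) : ℕ := {A | IsMeander S n A}.ncard

theorem finite_support_walkCount (S : Finset ℤ) (n : ℕ) :
    (Function.support fun k : ℤ => (walkCount S n k : ℤ)).Finite := by
  refine ((finite_walks S n).image finalAltitude).subset fun k hk => ?_
  have h : walkCount S n k ≠ 0 := by simpa using hk
  obtain ⟨A, hA⟩ := Set.nonempty_of_ncard_ne_zero h
  exact ⟨A, hA.1, hA.2⟩

/-- The full generating series `W(x,y) = ∑ w_{n,k} xⁿ yᵏ`, an element of `ℤ[y,y⁻¹][[x]]`. -/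
def W (S : Finset ℤ) : PowerSeries (LaurentPolynomial ℤ) :=
  PowerSeries.mk fun n =>
    AddMonoidAlgebra.ofCoeff
      (Finsupp.ofSupportFinite (fun k => (walkCount S n k : ℤ)) (finite_support_walkCount S n))

theorem coeff_W (S : Finset ℤ) (n : ℕ) (k : ℤ) :
    (PowerSeries.coeff n (W S)).coeff k = walkCount S n k := by
  simp [W, Finsupp.ofSupportFinite_coe]

/-- The generating series `M(x)` of meanders. -/
def M (S : Finset ℤ) : PowerSeries ℚ := PowerSeries.mk fun n => (meanderCount S n : ℚ)

/-- The characteristic polynomial `Γ(y) = ∑ y^u`, a Laurent polynomial. -/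
def Gam (S : Finset ℤ) : LaurentPolynomial ℤ := ∑ u ∈ S, LaurentPolynomial.T u

/-- The value of a Laurent polynomial with integer coefficients at a nonzero element of a field. -/
def evalAt {F : Type*} [Field F] (y : F) (hy : y ≠ 0) : LaurentPolynomial ℤ →+* F :=
  LaurentPolynomial.eval₂ (Int.castRingHom F) (Units.mk0 y hy)

/-- The variable `y` of the field `K((y))` of formal Laurent series. -/
def yvar (K : Type*) [Field K] : LaurentSeries K := HahnSeries.single 1 1

theorem yvar_ne_zero (K : Type*) [Field K] : yvar K ≠ 0 :=
  HahnSeries.single_ne_zero one_ne_zero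

/-- `W(x,y)`, viewed in `ℚ((y))[[x]]`. -/
def WLaurent (S : Finset ℤ) : PowerSeries (LaurentSeries ℚ) :=
  PowerSeries.map (evalAt (yvar ℚ) (yvar_ne_zero ℚ)) (W S)

/-- The operator `[y⁰]` from `ℚ((y))[[x]]` to `ℚ[[x]]`, taken coefficientwise in `x`. -/
def constTerm (F : PowerSeries (LaurentSeries ℚ)) : PowerSeries ℚ :=
  PowerSeries.mk fun n => (PowerSeries.coeff n F).coeff 0

/-- The series `A(x) = [y⁰] (y / (1 - y)) W(x,y)`, where `y / (1 - y)` is expanded in `ℚ((y))`. -/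
def A (S : Finset ℤ) : PowerSeries ℚ :=
  constTerm (PowerSeries.C (yvar ℚ / (1 - yvar ℚ)) * WLaurent S)

/-- `F(x)/x` for a power series `F` with zero constant term. -/
def divX (F : PowerSeries ℚ) : PowerSeries ℚ :=
  PowerSeries.mk fun n => PowerSeries.coeff (n + 1) F

/-- The formal integral `∫ F dx`: the antiderivative with zero constant term. -/
def integral (F : PowerSeries ℚ) : PowerSeries ℚ :=
  PowerSeries.mk fun n => if n = 0 then 0 else PowerSeries.coeff (n - 1) F / n

/-- `exp(F(x))`, for a power series `F` with zero constant term. -/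
def expOf (F : PowerSeries ℚ) : PowerSeries ℚ := (PowerSeries.exp ℚ).subst F

/-- Generalized power series in `x` over `K` with rational exponents (and well-ordered support). When
`K` is algebraically closed of characteristic zero, this field contains the field of Puiseux series
over `K`, which is algebraically closed, so every element algebraic over `K(x)` is a Puiseux series. -/
abbrev Puiseux (K : Type*) [Field K] : Type _ := HahnSeries ℚ K

/-- The series `x`. -/
def xvar (K : Type*) [Field K] : Puiseux K := HahnSeries.single 1 1

/-- A power series in `x` with rational coefficients, viewed as a Puiseux series. -/
def toPuiseux (K : Type*) [Field K] [CharZero K] : PowerSeries ℚ →+* Puiseux K :=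
  (HahnSeries.ofPowerSeries ℚ K).comp (PowerSeries.map (algebraMap ℚ K))

/-- `u⁻`, the largest `u` such that `-u ∈ S`; it is `0` when no element of `S` is negative. -/
def uMinus (S : Finset ℤ) : ℕ := S.sup fun u => (-u).toNat

/-- The polynomial `y^{u⁻} - x y^{u⁻} Γ(y)` in `y`, with coefficients in the field of Puiseux series;
all exponents `u + u⁻` are nonnegative. -/
def kernelPoly (K : Type*) [Field K] (S : Finset ℤ) : Polynomial (Puiseux K) :=
  Polynomial.X ^ uMinus S -
    Polynomial.C (xvar K) * ∑ u ∈ S, Polynomial.X ^ (u + (uMinus S : ℤ)).toNat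

/-- The small branches: the distinct roots `y(x)` of the kernel of positive valuation in `x`. -/
def smallBranches (K : Type*) [Field K] (S : Finset ℤ) : Finset (Puiseux K) := by
  classical exact (kernelPoly K S).roots.toFinset.filter fun y => 0 < y.orderTop

/-- The residue of a rational function `f` at `a`: the coefficient of `t⁻¹` in the Laurent expansion
of `f(a + t)` at `t = 0`. -/
def residue {L : Type*} [Field L] (f : RatFunc L) (a : L) : L :=
  HahnSeries.coeff (RatFunc.eval (HahnSeries.C : L →+* LaurentSeries L)
    (HahnSeries.C a + yvar L : LaurentSeries L) f) (-1 : ℤ)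

/-- The rational function `1 / ((1 - y) (1 - x Γ(y)))` of `y`, with coefficients in the field of
Puiseux series in `x`. It is `W(x,y) / (1 - y)`. -/
def ratFun (K : Type*) [Field K] (S : Finset ℤ) : RatFunc (Puiseux K) :=
  1 / ((1 - RatFunc.X) *
    (1 - RatFunc.C (xvar K) * evalAt (RatFunc.X : RatFunc (Puiseux K)) RatFunc.X_ne_zero (Gam S)))

end LatticeWalk

end

/-! Write `M(x,y)` for the series of meanders refined by final altitude. Appending a step and
discarding the walks that drop below the axis gives a Wiener–Hopf factorisation `(1 - xΓ(y)) M(x,y)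
= E(x,1/y)`, where `E - 1` involves only strictly negative powers of `y` (`exists_wienerHopf`).
Logarithmic differentiation in `x` turns it into `∂M/M - Γ/(1 - xΓ) = ∂E/E`: the first term has only
nonnegative powers of `y`, the right side only negative ones. Summing the coefficients of negative
powers kills `∂M/M`, sends `Γ/(1 - xΓ)` to `A(x)/x`, and agrees with `y = 1` on `∂E/E`. Comparison
with the value at `y = 1` gives `M'/M = Γ(1)/(1 - xΓ(1)) - A/x` (`derivative_eq_mul_meanderSeries`,
`derivative_M`). Both closed forms follow, since a power series over `ℚ` is determined by its
derivative and constant term.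

For the residues put `a = u⁻`, `Q(y) = y^a Γ(y)` and `x = t^a`, so that the kernel is `y^a - t^a
Q(y)`. If `a > 0` then `Q(0) = 1`, and Hensel's lemma yields one branch `Y = t z(t)` with `z(0) =
1`; the small branches are exactly its conjugates `Y(ζ^j t)`. Implicit differentiation shows that
the residue at `Y` is `t Y' / (a (1 - Y))`. Summing over the conjugates keeps the exponents
divisible by `a`, and Lagrange inversion (`coeff_X_mul_derivative_mul_inv`) identifies the
coefficient of `t^(an)` with `∑_{i < an} [y^i] Q^n`, which is `[x^n] A` (`coeff_A_eq_sum`). -/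

namespace LatticeWalk

open Polynomial LaurentPolynomial

/-! ### Counting constrained walks by their last step -/

/-- Walks with step set `S`, length `n` and final altitude `k`, all of whose altitudes satisfy `P`. -/
def constrainedWalks (P : ℤ → Prop) (S : Finset ℤ) (n : ℕ) (k : ℤ) :
    Set (Fin (n + 1) → ℤ × ℤ) :=
  {A | IsWalk S n A ∧ (∀ i, P (A i).2) ∧ finalAltitude A = k}

theorem finite_constrainedWalks (P : ℤ → Prop) (S : Finset ℤ) (n : ℕ) (k : ℤ) :
    (constrainedWalks P S n k).Finite :=
  (finite_walks S n).subset fun _ hA => hA.1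

theorem isWalk_snoc {S : Finset ℤ} {n : ℕ} {A : Fin (n + 1) → ℤ × ℤ} {p : ℤ × ℤ} :
    IsWalk S (n + 1) (Fin.snoc (α := fun _ => ℤ × ℤ) A p) ↔
      IsWalk S n A ∧ ∃ u ∈ S, p - A (Fin.last n) = (1, u) := by
  have h0 : (Fin.snoc (α := fun _ => ℤ × ℤ) A p : Fin (n + 1 + 1) → ℤ × ℤ) 0 = A 0 := by
    rw [← Fin.castSucc_zero, Fin.snoc_castSucc]
  simp only [IsWalk, Fin.forall_fin_succ' (n := n), h0, ← Fin.castSucc_succ, Fin.snoc_castSucc,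
    Fin.succ_last, Fin.snoc_last, and_assoc]

theorem ncard_constrainedWalks_zero (P : ℤ → Prop) (hP : P 0) (S : Finset ℤ) (k : ℤ) :
    (constrainedWalks P S 0 k).ncard = if k = 0 then 1 else 0 := by
  split_ifs with h
  · rw [Set.ncard_eq_one]
    refine ⟨fun _ => (0, 0), Set.eq_singleton_iff_unique_mem.2 ⟨?_, ?_⟩⟩
    · simp [constrainedWalks, IsWalk, finalAltitude, h, hP]
    · rintro A ⟨hA, -⟩
      funext i
      rw [show i = 0 from Subsingleton.elim (α := Fin 1) _ _, hA.1]
  · rw [Set.ncard_eq_zero (finite_constrainedWalks P S 0 k), Set.eq_empty_iff_forall_notMem]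
    rintro A ⟨hA, -, hk⟩
    apply h
    rw [← hk, finalAltitude, show Fin.last 0 = 0 from rfl, hA.1]

theorem ncard_constrainedWalks_of_not (P : ℤ → Prop) (S : Finset ℤ) (n : ℕ) (k : ℤ)
    (hk : ¬ P k) : (constrainedWalks P S n k).ncard = 0 := by
  rw [Set.ncard_eq_zero (finite_constrainedWalks P S n k), Set.eq_empty_iff_forall_notMem]
  rintro A ⟨-, hA, rfl⟩
  exact hk (hA _)

/-- Removing the last step is a bijection. A general `P` serves both all walks and meanders. -/
theorem ncard_constrainedWalks_succ (P : ℤ → Prop) (S : Finset ℤ) (n : ℕ) (k : ℤ) (hk : P k) :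
    (constrainedWalks P S (n + 1) k).ncard =
      ∑ u ∈ S, (constrainedWalks P S n (k - u)).ncard := by
  let F : (Σ u : S, constrainedWalks P S n (k - u)) → constrainedWalks P S (n + 1) k := fun x =>
    ⟨Fin.snoc (α := fun _ => ℤ × ℤ) x.2.1 (x.2.1 (Fin.last n) + (1, (x.1 : ℤ))), by
      obtain ⟨⟨u, hu⟩, A, hA, hP, hAk⟩ := x
      have hAk' : (A (Fin.last n)).2 = k - u := hAk
      refine ⟨isWalk_snoc.2 ⟨hA, u, hu, by simp⟩, ?_, ?_⟩
      · rw [Fin.forall_fin_succ']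
        simp only [Fin.snoc_castSucc, Fin.snoc_last]
        exact ⟨hP, by simpa [hAk'] using hk⟩
      · simp [finalAltitude, hAk']⟩
  have hF : Function.Bijective F := by
    constructor
    · rintro ⟨⟨u, hu⟩, A, hA⟩ ⟨⟨v, hv⟩, B, hB⟩ h
      have h' := congrArg Subtype.val h
      obtain ⟨rfl, h2⟩ := (Fin.snoc_inj (α := fun _ => ℤ × ℤ)).1 h'
      obtain rfl : u = v := by simpa using h2
      rfl
    · rintro ⟨A, hA, hP, hAk⟩
      rw [← Fin.snoc_init_self (α := fun _ => ℤ × ℤ) A] at hA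
      obtain ⟨hA', u, hu, hlast⟩ := isWalk_snoc.1 hA
      have hlast' : A (Fin.last (n + 1)) =
          Fin.init (α := fun _ => ℤ × ℤ) A (Fin.last n) + (1, u) := by
        rw [← hlast]; abel
      refine ⟨⟨⟨u, hu⟩, Fin.init (α := fun _ => ℤ × ℤ) A, hA', fun i => hP _, ?_⟩, ?_⟩
      · have h2 : (A (Fin.last (n + 1))).2 = k := hAk
        rw [hlast'] at h2
        simpa [finalAltitude, eq_sub_iff_add_eq] using h2
      · apply Subtype.ext
        change Fin.snoc (α := fun _ => ℤ × ℤ) (Fin.init (α := fun _ => ℤ × ℤ) A) _ = A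
        rw [← hlast']
        exact Fin.snoc_init_self (α := fun _ => ℤ × ℤ) A
  have := fun u : S => (finite_constrainedWalks P S n (k - u)).to_subtype
  have h := Nat.card_eq_of_bijective F hF
  rw [Nat.card_sigma] at h
  simp only [Nat.card_coe_set_eq] at h
  rw [← h, Finset.sum_coe_sort S fun u => (constrainedWalks P S n (k - u)).ncard]

/-! ### Walks as powers of `Γ`, meanders as truncated products -/

theorem coeff_T_mul {R : Type*} [Semiring R] (u : ℤ) (f : R[T;T⁻¹]) (k : ℤ) :
    (T u * f).coeff k = f.coeff (k - u) := by
  rw [T_mul]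
  induction f using LaurentPolynomial.induction_on' with
  | add p q hp hq => simp only [add_mul, AddMonoidAlgebra.coeff_add, Finsupp.add_apply, hp, hq]
  | C_mul_T n a =>
    rw [mul_T_assoc, ← single_eq_C_mul_T, ← single_eq_C_mul_T]
    simp only [AddMonoidAlgebra.coeff_single, Finsupp.single_apply]
    exact if_congr (by omega) rfl rfl

theorem coeff_Gam_mul (S : Finset ℤ) (f : ℤ[T;T⁻¹]) (k : ℤ) :
    (Gam S * f).coeff k = ∑ u ∈ S, f.coeff (k - u) := by
  rw [Gam, Finset.sum_mul, AddMonoidAlgebra.coeff_sum, Finsupp.finsetSum_apply]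
  simp only [coeff_T_mul]

theorem walkCount_eq (S : Finset ℤ) (n : ℕ) (k : ℤ) :
    walkCount S n k = (constrainedWalks (fun _ => True) S n k).ncard := by
  simp [walkCount, constrainedWalks]

theorem coeff_Gam_pow (S : Finset ℤ) (n : ℕ) (k : ℤ) :
    (Gam S ^ n).coeff k = walkCount S n k := by
  induction n generalizing k with
  | zero =>
    rw [walkCount_eq, ncard_constrainedWalks_zero _ trivial, pow_zero, ← T_zero, T_apply]
    simp [eq_comm]
  | succ n ih =>
    rw [walkCount_eq, ncard_constrainedWalks_succ _ _ _ _ trivial, pow_succ', coeff_Gam_mul]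
    simp [ih, walkCount_eq]

theorem W_eq (S : Finset ℤ) : W S = PowerSeries.mk fun n => Gam S ^ n := by
  ext n k
  rw [coeff_W, PowerSeries.coeff_mk, coeff_Gam_pow]

/-- The polynomials counting meanders of length `n` according to their final altitude. -/
noncomputable def meanderPoly (S : Finset ℤ) : ℕ → ℤ[X]
  | 0 => 1
  | n + 1 => LaurentPolynomial.trunc (Gam S * toLaurent (meanderPoly S n))

/-- The factor `X` keeps the constant term out of the second summand, which is thus a polynomial in
`1/y` without constant term. -/
theorem exists_eq_trunc_add {R : Type*} [CommSemiring R] (f : R[T;T⁻¹]) :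
    ∃ q : R[X], f = toLaurent (LaurentPolynomial.trunc f) + invert (toLaurent (X * q)) := by
  induction f using LaurentPolynomial.induction_on' with
  | add f g hf hg =>
    obtain ⟨p, hp⟩ := hf
    obtain ⟨q, hq⟩ := hg
    refine ⟨p + q, ?_⟩
    conv_lhs => rw [hp, hq]
    simp only [map_add, mul_add]
    ring
  | C_mul_T n a =>
    rw [trunc_C_mul_T]
    split_ifs with hn
    · refine ⟨0, ?_⟩
      obtain ⟨m, rfl⟩ := Int.eq_ofNat_of_zero_le hn
      rw [Int.toNat_natCast, ← Polynomial.C_mul_X_pow_eq_monomial]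
      simp
    · obtain ⟨m, hm⟩ : ∃ m : ℕ, n = -(m + 1 : ℕ) := ⟨(-n - 1).toNat, by omega⟩
      refine ⟨Polynomial.C a * X ^ m, ?_⟩
      rw [show X * (Polynomial.C a * X ^ m) = Polynomial.C a * X ^ (m + 1) by ring]
      simp [hm]

theorem coeff_toLaurent_natCast {R : Type*} [Semiring R] (p : R[X]) (k : ℕ) :
    (toLaurent p).coeff (k : ℤ) = p.coeff k := by
  rw [coeff_toLaurent]
  exact Finsupp.mapDomain_apply Nat.cast_injective _ _

theorem coeff_toLaurent_of_neg {R : Type*} [Semiring R] (p : R[X]) {k : ℤ} (hk : k < 0) :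
    (toLaurent p).coeff k = 0 := by
  rw [coeff_toLaurent]
  refine Finsupp.mapDomain_of_notMem_range _ _ ?_
  rintro ⟨m, rfl⟩
  exact absurd hk (by simp)

theorem coeff_toLaurent_trunc {R : Type*} [CommSemiring R] (f : R[T;T⁻¹]) {k : ℤ} (hk : 0 ≤ k) :
    (toLaurent (LaurentPolynomial.trunc f)).coeff k = f.coeff k := by
  obtain ⟨q, hq⟩ := exists_eq_trunc_add f
  obtain ⟨m, rfl⟩ := Int.eq_ofNat_of_zero_le hk
  conv_rhs => rw [hq]
  rw [AddMonoidAlgebra.coeff_add, Finsupp.add_apply, invert_apply]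
  rcases Nat.eq_zero_or_pos m with rfl | hm
  · rw [show -((0 : ℕ) : ℤ) = (0 : ℕ) by simp, coeff_toLaurent_natCast (X * q),
      coeff_X_mul_zero, add_zero]
  · rw [coeff_toLaurent_of_neg (X * q) (by omega), add_zero]

theorem coeff_toLaurent_meanderPoly (S : Finset ℤ) (n : ℕ) (k : ℤ) :
    (toLaurent (meanderPoly S n)).coeff k = (constrainedWalks (0 ≤ ·) S n k).ncard := by
  induction n generalizing k with
  | zero =>
    rw [ncard_constrainedWalks_zero _ le_rfl, meanderPoly, toLaurent_one, ← T_zero, T_apply]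
    simp [eq_comm]
  | succ n ih =>
    by_cases hk : 0 ≤ k
    · rw [ncard_constrainedWalks_succ _ _ _ _ hk, meanderPoly, coeff_toLaurent_trunc _ hk,
        coeff_Gam_mul]
      simp only [ih, Nat.cast_sum]
    · rw [ncard_constrainedWalks_of_not _ _ _ _ hk, coeff_toLaurent_of_neg _ (by omega)]
      simp

theorem eval_one_meanderPoly (S : Finset ℤ) (n : ℕ) :
    (meanderPoly S n).eval 1 = meanderCount S n := by
  have hfin : {A | IsMeander S n A}.Finite := (finite_walks S n).subset fun _ hA => hA.1
  have key : ∀ k : ℕ, ((meanderPoly S n).coeff k : ℤ) =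
      (constrainedWalks (0 ≤ ·) S n k).ncard := fun k => by
    rw [← coeff_toLaurent_meanderPoly, coeff_toLaurent_natCast]
  rw [meanderCount, Set.ncard_eq_toFinset_card _ hfin,
    Finset.card_eq_sum_card_fiberwise (f := fun A => (finalAltitude A).toNat)
      (t := Finset.range ((meanderPoly S n).natDegree + 1)), eval_eq_sum_range]
  · push_cast
    refine Finset.sum_congr rfl fun k _ => ?_
    rw [one_pow, mul_one, key, Nat.cast_inj, ← Set.ncard_coe_finset]
    congr 1
    ext A
    simp only [constrainedWalks, Set.mem_ofPred_eq, IsMeander, Finset.coe_filter,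
      Set.Finite.mem_toFinset, and_assoc]
    refine and_congr_right fun _ => and_congr_right fun h => ?_
    have : 0 ≤ finalAltitude A := h _
    omega
  · intro A hA
    simp only [Set.Finite.coe_toFinset, Set.mem_ofPred_eq] at hA
    rw [Finset.coe_range, Set.mem_Iio, Nat.lt_succ_iff]
    apply le_natDegree_of_ne_zero
    rw [key, Nat.cast_ne_zero]
    refine (Set.ncard_pos (finite_constrainedWalks _ S n _)).2 ⟨A, hA.1, hA.2, ?_⟩ |>.ne'
    exact (Int.toNat_of_nonneg (hA.2 (Fin.last n))).symm

end LatticeWalk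

/-! ### Negative powers of `y` and the Wiener–Hopf factorisation -/

namespace LatticeWalk

open Polynomial LaurentPolynomial

/-- `[y⁰] (y / (1 - y)) f(y)`, the sum of the coefficients of the negative powers in `f`. -/
noncomputable def negSum : ℤ[T;T⁻¹] →+ ℚ where
  toFun f := (yvar ℚ / (1 - yvar ℚ) * evalAt (yvar ℚ) (yvar_ne_zero ℚ) f).coeff 0
  map_zero' := by simp
  map_add' f g := by simp [mul_add]

theorem coeff_A (S : Finset ℤ) (n : ℕ) : PowerSeries.coeff n (A S) = negSum (Gam S ^ n) := by
  simp [A, constTerm, WLaurent, W_eq, negSum]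

theorem yvar_div_one_sub (K : Type*) [Field K] :
    yvar K / (1 - yvar K) =
      HahnSeries.ofPowerSeries ℤ K (PowerSeries.X * PowerSeries.mk fun _ => 1) := by
  have h : yvar K = HahnSeries.ofPowerSeries ℤ K PowerSeries.X := by
    rw [HahnSeries.ofPowerSeries_X, yvar]
  have h2 : (PowerSeries.mk fun _ => (1 : K)) * (1 - PowerSeries.X) = 1 :=
    PowerSeries.mk_one_mul_one_sub_eq_one K
  have h3 : (1 - PowerSeries.X : PowerSeries K) ≠ 0 := right_ne_zero_of_mul (h2.trans_ne one_ne_zero)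
  rw [h, div_eq_iff, ← map_one (HahnSeries.ofPowerSeries ℤ K), ← map_sub, ← map_mul, mul_assoc, h2,
    mul_one]
  rw [← map_one (HahnSeries.ofPowerSeries ℤ K), ← map_sub]
  exact (map_ne_zero_iff _ HahnSeries.ofPowerSeries_injective).2 h3

theorem evalAt_T {F : Type*} [Field F] (y : F) (hy : y ≠ 0) (k : ℤ) :
    evalAt y hy (T k) = y ^ k := by
  simp [evalAt]

theorem evalAt_C {F : Type*} [Field F] (y : F) (hy : y ≠ 0) (a : ℤ) :
    evalAt y hy (LaurentPolynomial.C a) = a := by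
  simp [evalAt]

theorem evalAt_toLaurent {F : Type*} [Field F] (y : F) (hy : y ≠ 0) (p : ℤ[X]) :
    evalAt y hy (toLaurent p) = p.eval₂ (Int.castRingHom F) y := by
  simp [evalAt]

theorem yvar_zpow (K : Type*) [Field K] (k : ℤ) : yvar K ^ k = HahnSeries.single k 1 := by
  exact (RatFunc.single_zpow k).symm

theorem negSum_C_mul_T (a k : ℤ) :
    negSum (LaurentPolynomial.C a * T k) = if k < 0 then (a : ℚ) else 0 := by
  change (yvar ℚ / (1 - yvar ℚ) * evalAt (yvar ℚ) (yvar_ne_zero ℚ) _).coeff 0 = _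
  rw [map_mul, evalAt_T, evalAt_C, yvar_div_one_sub, yvar_zpow, mul_left_comm]
  rw [← map_intCast (HahnSeries.C : ℚ →+* LaurentSeries ℚ), HahnSeries.C_mul_eq_smul,
    HahnSeries.coeff_smul]
  have := HahnSeries.coeff_mul_single_add (r := (1 : ℚ)) (a := -k) (b := k)
    (x := HahnSeries.ofPowerSeries ℤ ℚ (PowerSeries.X * PowerSeries.mk fun _ => 1))
  rw [neg_add_cancel] at this
  rw [this, mul_one]
  split_ifs with hk
  · obtain ⟨m, hm⟩ : ∃ m : ℕ, -k = (m + 1 : ℕ) := ⟨(-k - 1).toNat, by omega⟩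
    rw [hm, HahnSeries.ofPowerSeries_apply_coeff, PowerSeries.coeff_succ_X_mul]
    simp
  · rcases (not_lt.1 hk).eq_or_lt with rfl | hk
    · rw [show -(0 : ℤ) = (0 : ℕ) by simp, HahnSeries.ofPowerSeries_apply_coeff]
      simp
    · rw [HahnSeries.ofPowerSeries_apply, HahnSeries.embDomain_of_notMem_range]
      · simp
      · rintro ⟨m, hm⟩
        have : (m : ℤ) = -k := hm
        omega

theorem negSum_toLaurent (p : ℤ[X]) : negSum (toLaurent p) = 0 := by
  induction p using Polynomial.induction_on' with
  | add p q hp hq => simp [hp, hq]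
  | monomial n a => rw [← C_mul_X_pow_eq_monomial, toLaurent_C_mul_X_pow, negSum_C_mul_T]; simp

theorem negSum_T_neg_mul_toLaurent (N : ℕ) (p : ℤ[X]) :
    negSum (T (-N) * toLaurent p) = ∑ i ∈ Finset.range N, (p.coeff i : ℚ) := by
  induction p using Polynomial.induction_on' with
  | add p q hp hq =>
    simp only [map_add, mul_add, hp, hq, coeff_add, Int.cast_add, Finset.sum_add_distrib]
  | monomial n a =>
    rw [← C_mul_X_pow_eq_monomial, toLaurent_C_mul_X_pow, T_mul, mul_T_assoc, negSum_C_mul_T]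
    simp only [coeff_C_mul_X_pow, Int.cast_ite, Int.cast_zero, Finset.sum_ite_eq',
      Finset.mem_range]
    exact if_congr (by omega) rfl rfl

/-- When only negative powers occur, summing their coefficients is setting `y = 1`. This is what
links `A` to the specialisation `M(x,1)`. -/
theorem negSum_invert_toLaurent_X_mul (p : ℤ[X]) :
    negSum (invert (toLaurent (X * p))) = (p.eval 1 : ℤ) := by
  induction p using Polynomial.induction_on' with
  | add p q hp hq => simp only [mul_add, map_add, hp, hq, eval_add, Int.cast_add]
  | monomial n a =>
    rw [← C_mul_X_pow_eq_monomial, mul_left_comm, ← pow_succ', toLaurent_C_mul_X_pow, map_mul,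
      invert_C, invert_T, negSum_C_mul_T, if_pos (by omega)]
    simp

theorem evalAt_one_toLaurent (p : ℤ[X]) :
    evalAt (1 : ℚ) one_ne_zero (toLaurent p) = (p.eval 1 : ℤ) := by
  rw [evalAt_toLaurent]
  exact (eval₂_at_apply (Int.castRingHom ℚ) 1).symm ▸ by simp

theorem evalAt_one_invert_toLaurent (p : ℤ[X]) :
    evalAt (1 : ℚ) one_ne_zero (invert (toLaurent p)) = (p.eval 1 : ℤ) := by
  induction p using Polynomial.induction_on' with
  | add p q hp hq => simp only [map_add, hp, hq, eval_add, Int.cast_add]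
  | monomial n a =>
    rw [← C_mul_X_pow_eq_monomial, toLaurent_C_mul_X_pow, map_mul, invert_C, invert_T, map_mul,
      evalAt_T, evalAt_C]
    simp

theorem derivative_map {R R' : Type*} [CommSemiring R] [CommSemiring R'] (φ : R →+* R')
    (F : PowerSeries R) :
    PowerSeries.derivative R' (PowerSeries.map φ F) =
      PowerSeries.map φ (PowerSeries.derivative R F) := by
  ext n
  simp [PowerSeries.coeff_derivative]

/-- The generating series of meanders according to length and final altitude. -/
noncomputable def meanderSeries (S : Finset ℤ) : PowerSeries ℤ[X] :=
  PowerSeries.mk (meanderPoly S)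

/-- The coefficient of `x^(n+1)` on the left is minus the part of `Γ · meanderPoly S n` removed by
truncation, hence the sign of the witness. -/
theorem exists_wienerHopf (S : Finset ℤ) : ∃ q : ℕ → ℤ[X],
    (1 - PowerSeries.X * PowerSeries.C (Gam S)) *
        PowerSeries.map (toLaurent : ℤ[X] →+* ℤ[T;T⁻¹]) (meanderSeries S) =
      PowerSeries.map ((invert : ℤ[T;T⁻¹] ≃ₐ[ℤ] ℤ[T;T⁻¹]).toRingEquiv.toRingHom.comp toLaurent)
        (1 + PowerSeries.X * PowerSeries.mk fun n => X * q n) := by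
  choose q hq using fun n => exists_eq_trunc_add (Gam S * toLaurent (meanderPoly S n))
  refine ⟨fun n => -q n, ?_⟩
  ext1 n
  cases n with
  | zero =>
    simp only [sub_mul, one_mul, mul_assoc, map_sub, map_add, PowerSeries.coeff_zero_X_mul,
      PowerSeries.coeff_map, meanderSeries, PowerSeries.coeff_mk, PowerSeries.coeff_one, if_true,
      map_one, map_zero, sub_zero, add_zero, meanderPoly]
  | succ n =>
    have h := hq n
    rw [← sub_eq_iff_eq_add', ← meanderPoly.eq_2] at h
    simp only [sub_mul, one_mul, mul_assoc, map_sub, map_add, PowerSeries.coeff_succ_X_mul,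
      PowerSeries.coeff_map, PowerSeries.coeff_C_mul, meanderSeries, PowerSeries.coeff_mk,
      PowerSeries.coeff_one, mul_neg, map_neg, n.succ_ne_zero, if_false, map_zero, zero_add,
      RingHom.comp_apply]
    rw [← neg_sub]
    exact congrArg Neg.neg h

theorem constantCoeff_one_add_X_mul {R : Type*} [CommRing R] (F : PowerSeries R) :
    PowerSeries.constantCoeff (1 + PowerSeries.X * F) = ((1 : Rˣ) : R) := by
  simp

theorem derivative_eq_mul_meanderSeries (S : Finset ℤ) : ∃ B : PowerSeries ℤ[X],
    PowerSeries.derivative ℤ[X] (meanderSeries S) = B * meanderSeries S ∧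
    ∀ n, (((PowerSeries.coeff n B).eval 1 : ℤ) : ℚ) =
      evalAt (1 : ℚ) one_ne_zero (Gam S) ^ (n + 1) - PowerSeries.coeff (n + 1) (A S) := by
  obtain ⟨q, hq⟩ := exists_wienerHopf S
  set E : PowerSeries ℤ[X] := 1 + PowerSeries.X * PowerSeries.mk fun n => X * q n with hE
  set φ : ℤ[X] →+* ℤ[T;T⁻¹] := toLaurent
  set ψ : ℤ[X] →+* ℤ[T;T⁻¹] :=
    (invert : ℤ[T;T⁻¹] ≃ₐ[ℤ] ℤ[T;T⁻¹]).toRingEquiv.toRingHom.comp toLaurent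
  set M' := PowerSeries.invOfUnit (meanderSeries S) 1
  set E' := PowerSeries.invOfUnit E 1
  have hMM : meanderSeries S * M' = 1 := PowerSeries.mul_invOfUnit _ _ (by
    simp [meanderSeries, meanderPoly, ← PowerSeries.coeff_zero_eq_constantCoeff_apply])
  have hEE : E * E' = 1 := PowerSeries.mul_invOfUnit _ _ (constantCoeff_one_add_X_mul _)
  set G : PowerSeries ℤ[T;T⁻¹] := PowerSeries.mk fun n => Gam S ^ n
  have hG : (1 - PowerSeries.X * PowerSeries.C (Gam S)) * G = 1 := by
    ext1 n
    cases n with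
    | zero => simp [sub_mul, mul_assoc, G]
    | succ n => simp [sub_mul, mul_assoc, G, PowerSeries.coeff_succ_X_mul, pow_succ',
        PowerSeries.coeff_one]
  set E1 : PowerSeries ℤ[X] := PowerSeries.mk fun n => q n * (n + 1)
  have hdE : PowerSeries.derivative ℤ[X] E = PowerSeries.C X * E1 := by
    ext1 n
    simp only [hE, E1, PowerSeries.coeff_derivative, PowerSeries.coeff_succ_X_mul, map_add,
      PowerSeries.coeff_one, n.succ_ne_zero, if_false, zero_mul, zero_add, PowerSeries.coeff_mk,
      PowerSeries.coeff_C_mul, mul_assoc]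
  refine ⟨PowerSeries.derivative ℤ[X] (meanderSeries S) * M', by
    rw [mul_assoc, mul_comm M', hMM, mul_one], fun n => ?_⟩
  have hd := congrArg (PowerSeries.derivative ℤ[T;T⁻¹]) hq
  rw [derivative_map, hdE, Derivation.leibniz, derivative_map] at hd
  simp only [map_sub, Derivation.leibniz, PowerSeries.derivative_X, PowerSeries.derivative_C,
    PowerSeries.derivative_one, smul_eq_mul, mul_one, mul_zero, zero_add, zero_sub] at hd
  have hMM' := congrArg (PowerSeries.map φ) hMM
  have hEE' := congrArg (PowerSeries.map ψ) hEE
  rw [map_mul, map_one] at hMM' hEE'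
  -- Logarithmic derivative of the factorisation; `G` is `1/(1 - xΓ)`, and the right side has only
  -- negative powers of `y`.
  have key : PowerSeries.map φ (PowerSeries.derivative ℤ[X] (meanderSeries S) * M') -
      PowerSeries.C (Gam S) * G = PowerSeries.map ψ (PowerSeries.C X * E1 * E') := by
    rw [map_mul _ _ E', map_mul, ← hd]
    have hEinv : PowerSeries.map ψ E' = G * PowerSeries.map φ M' := by
      linear_combination (G * PowerSeries.map φ M') * hEE' - PowerSeries.map ψ E' * hMM' -
        PowerSeries.map ψ E' * (PowerSeries.map φ (meanderSeries S)) * PowerSeries.map φ M' * hG +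
        PowerSeries.map ψ E' * G * PowerSeries.map φ M' * hq
    rw [hEinv]
    linear_combination (- PowerSeries.map φ (PowerSeries.derivative ℤ[X] (meanderSeries S)) *
      PowerSeries.map φ M') * hG + PowerSeries.C (Gam S) * G * hMM'
  have hn := congrArg (PowerSeries.coeff n) key
  rw [mul_assoc, map_sub, PowerSeries.coeff_map, PowerSeries.coeff_C_mul, PowerSeries.coeff_map,
    PowerSeries.coeff_C_mul, PowerSeries.coeff_mk, ← pow_succ'] at hn
  -- Evaluation at `y = 1` and `negSum` take the same value on the right side; eliminating it leaves
  -- the claim.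
  have h1 := congrArg (evalAt (1 : ℚ) one_ne_zero) hn
  have h2 := congrArg negSum hn
  have h3 := negSum_invert_toLaurent_X_mul (PowerSeries.coeff n (E1 * E'))
  have h4 := evalAt_one_invert_toLaurent (X * PowerSeries.coeff n (E1 * E'))
  have h5 := negSum_toLaurent (PowerSeries.coeff n
    (PowerSeries.derivative ℤ[X] (meanderSeries S) * M'))
  have h6 := evalAt_one_toLaurent (PowerSeries.coeff n
    (PowerSeries.derivative ℤ[X] (meanderSeries S) * M'))
  rw [eval_mul, eval_X, one_mul] at h4
  rw [map_sub, map_pow] at h1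
  rw [map_sub, ← coeff_A] at h2
  have h1' := h1.trans h4
  have h2' := h2.trans h3
  have h6' : evalAt (1 : ℚ) one_ne_zero (φ _) = _ := h6
  have h5' : negSum (φ _) = 0 := h5
  rw [h5'] at h2'
  rw [h6'] at h1'
  linarith

end LatticeWalk

/-! ### Solving the differential equation for `M` -/

namespace LatticeWalk

open Polynomial

theorem derivative_M (S : Finset ℤ) :
    PowerSeries.derivative ℚ (M S) =
      (PowerSeries.mk fun n => evalAt (1 : ℚ) one_ne_zero (Gam S) ^ (n + 1) -
        PowerSeries.coeff (n + 1) (A S)) * M S := by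
  obtain ⟨B, hB, hB'⟩ := derivative_eq_mul_meanderSeries S
  set φ : ℤ[X] →+* ℚ := (Int.castRingHom ℚ).comp (evalRingHom 1)
  have hM : M S = PowerSeries.map φ (meanderSeries S) := by
    ext n
    simp [M, meanderSeries, φ, eval_one_meanderPoly]
  rw [hM, derivative_map, hB, map_mul]
  congr 1
  ext n
  rw [PowerSeries.coeff_map, PowerSeries.coeff_mk, ← hB']
  rfl

theorem constantCoeff_A (S : Finset ℤ) : PowerSeries.constantCoeff (A S) = 0 := by
  rw [← PowerSeries.coeff_zero_eq_constantCoeff_apply, coeff_A, pow_zero,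
    ← Polynomial.toLaurent_one, negSum_toLaurent]

theorem constantCoeff_M (S : Finset ℤ) : PowerSeries.constantCoeff (M S) = 1 := by
  rw [← PowerSeries.coeff_zero_eq_constantCoeff_apply, M, PowerSeries.coeff_mk]
  have := eval_one_meanderPoly S 0
  rw [meanderPoly, eval_one] at this
  exact_mod_cast this.symm

theorem constantCoeff_integral (F : PowerSeries ℚ) :
    PowerSeries.constantCoeff (integral F) = 0 := by
  rw [← PowerSeries.coeff_zero_eq_constantCoeff_apply]
  simp [integral]

theorem derivative_integral (F : PowerSeries ℚ) :
    PowerSeries.derivative ℚ (integral F) = F := by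
  ext n
  rw [PowerSeries.coeff_derivative, integral, PowerSeries.coeff_mk, if_neg n.succ_ne_zero,
    Nat.add_sub_cancel]
  push_cast
  field_simp

/-- The quotient `F/G` has zero derivative. -/
theorem eq_of_derivative_eq_mul {F G H : PowerSeries ℚ}
    (hF : PowerSeries.derivative ℚ F = H * F) (hG : PowerSeries.derivative ℚ G = H * G)
    (hF0 : PowerSeries.constantCoeff F = 1) (hG0 : PowerSeries.constantCoeff G = 1) : F = G := by
  have hinv : G⁻¹ * G = 1 := PowerSeries.inv_mul_cancel _ (by simp [hG0])
  have h : F * G⁻¹ = 1 := by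
    apply PowerSeries.derivative.ext
    · rw [Derivation.leibniz, PowerSeries.derivative_inv', hF, hG, PowerSeries.derivative_one]
      simp only [smul_eq_mul]
      linear_combination (-F * H * G⁻¹) * hinv
    · simp [hF0, hG0]
  calc F = F * (G⁻¹ * G) := by rw [hinv, mul_one]
    _ = G := by rw [← mul_assoc, h, one_mul]

theorem constantCoeff_expOf {F : PowerSeries ℚ} (hF : PowerSeries.constantCoeff F = 0) :
    PowerSeries.constantCoeff (expOf F) = 1 := by
  have h := PowerSeries.constantCoeff_subst_eq_zero (R := ℚ) (a := F) hF (PowerSeries.exp ℚ - 1)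
    (by simp)
  have hs : PowerSeries.HasSubst F := PowerSeries.HasSubst.of_constantCoeff_zero' hF
  rw [← PowerSeries.coe_substAlgHom hs, map_sub, map_one, PowerSeries.coe_substAlgHom hs, map_sub,
    map_one, sub_eq_zero] at h
  exact h

theorem derivative_expOf {F : PowerSeries ℚ} (hF : PowerSeries.constantCoeff F = 0) :
    PowerSeries.derivative ℚ (expOf F) = PowerSeries.derivative ℚ F * expOf F := by
  have hs : PowerSeries.HasSubst F := PowerSeries.HasSubst.of_constantCoeff_zero' hF
  rw [expOf, PowerSeries.derivative_subst hs, PowerSeries.derivative_exp, mul_comm]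

theorem derivative_logOf {F : PowerSeries ℚ} (hF : PowerSeries.constantCoeff F = 1) :
    PowerSeries.derivative ℚ (PowerSeries.logOf F) = F⁻¹ * PowerSeries.derivative ℚ F := by
  have hs : PowerSeries.HasSubst (F - 1) :=
    PowerSeries.HasSubst.of_constantCoeff_zero' (by simp [hF])
  rw [PowerSeries.logOf, PowerSeries.derivative_subst hs, map_sub, PowerSeries.derivative_one,
    sub_zero]
  congr 1
  have h : (PowerSeries.derivative ℚ (PowerSeries.log ℚ)) * (1 + PowerSeries.X) = 1 := by
    ext n
    rw [PowerSeries.deriv_log, mul_add, mul_one, map_add]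
    cases n with
    | zero => simp
    | succ n => simp [PowerSeries.coeff_succ_mul_X, PowerSeries.coeff_one, pow_succ]
  have h2 := congrArg (PowerSeries.subst (F - 1)) h
  rw [← PowerSeries.coe_substAlgHom hs, map_mul, map_add, map_one,
    PowerSeries.coe_substAlgHom hs, PowerSeries.subst_X hs, add_sub_cancel] at h2
  exact (PowerSeries.eq_inv_iff_mul_eq_one (by simp [hF])).2 h2

theorem M_eq_expOf (S : Finset ℤ) :
    M S = expOf (-integral (divX (A S))) *
        (1 - PowerSeries.X * PowerSeries.C (evalAt (1 : ℚ) one_ne_zero (Gam S)))⁻¹ := by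
  set g := evalAt (1 : ℚ) one_ne_zero (Gam S)
  set D : PowerSeries ℚ := 1 - PowerSeries.X * PowerSeries.C g with hD
  have h0 : PowerSeries.constantCoeff (-integral (divX (A S))) = 0 := by
    rw [map_neg, constantCoeff_integral, neg_zero]
  have hD0 : PowerSeries.constantCoeff D = 1 := by simp [hD]
  have hgeom : PowerSeries.mk (fun n => g ^ (n + 1)) = PowerSeries.C g * D⁻¹ := by
    rw [PowerSeries.eq_mul_inv_iff_mul_eq (by simp [hD0])]
    ext n
    rw [hD, mul_sub, mul_one, ← mul_assoc, map_sub, PowerSeries.coeff_mul_C]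
    cases n with
    | zero => simp
    | succ n => simp [PowerSeries.coeff_succ_mul_X, pow_succ]
  refine eq_of_derivative_eq_mul (derivative_M S) ?_ (constantCoeff_M S) ?_
  · have hsub : (PowerSeries.mk fun n => g ^ (n + 1) - PowerSeries.coeff (n + 1) (A S)) =
        PowerSeries.C g * D⁻¹ - divX (A S) := by
      rw [← hgeom]
      ext n
      simp [divX]
    have hDd : PowerSeries.derivative ℚ D = -PowerSeries.C g := by
      simp [hD, Derivation.leibniz]
    rw [hsub, Derivation.leibniz, derivative_expOf h0, map_neg, derivative_integral,
      PowerSeries.derivative_inv', hDd]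
    simp only [smul_eq_mul]
    ring
  · rw [map_mul, constantCoeff_expOf h0]
    simp [hD0]

theorem logOf_M (S : Finset ℤ) :
    PowerSeries.logOf (M S) =
      -PowerSeries.logOf (1 - PowerSeries.X *
          PowerSeries.C (evalAt (1 : ℚ) one_ne_zero (Gam S))) - integral (divX (A S)) := by
  have hM0 := constantCoeff_M S
  have hM := M_eq_expOf S
  set D : PowerSeries ℚ := 1 - PowerSeries.X * PowerSeries.C (evalAt (1 : ℚ) one_ne_zero (Gam S))
    with hD
  have h0 : PowerSeries.constantCoeff (-integral (divX (A S))) = 0 := by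
    rw [map_neg, constantCoeff_integral, neg_zero]
  have hD0 : PowerSeries.constantCoeff D = 1 := by simp [hD]
  have hDD : D⁻¹ * D = 1 := PowerSeries.inv_mul_cancel _ (by simp [hD0])
  have hMM : (M S)⁻¹ * M S = 1 := PowerSeries.inv_mul_cancel _ (by simp [hM0])
  apply PowerSeries.derivative.ext
  · have hd := congrArg (PowerSeries.derivative ℚ) hM
    rw [Derivation.leibniz, derivative_expOf h0, map_neg, derivative_integral,
      PowerSeries.derivative_inv'] at hd
    simp only [smul_eq_mul] at hd
    rw [map_sub, map_neg, derivative_logOf hM0, derivative_logOf hD0, derivative_integral, hd]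
    linear_combination (-D⁻¹ * PowerSeries.derivative ℚ D - divX (A S)) * hMM +
      (M S)⁻¹ * (D⁻¹ * PowerSeries.derivative ℚ D + divX (A S)) * hM
  · rw [map_sub, map_neg, PowerSeries.constantCoeff_logOf hM0, PowerSeries.constantCoeff_logOf hD0,
      constantCoeff_integral, neg_zero, sub_zero]

end LatticeWalk

/-! ### The branch `Y = t z(t)` and Lagrange inversion -/

namespace LatticeWalk

open Polynomial

section PowerSeries

variable {K : Type*} [Field K]

theorem isAdicComplete_span_X :
    IsAdicComplete (Ideal.span {(PowerSeries.X : PowerSeries K)}) (PowerSeries K) where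
  haus' F hF := by
    ext n
    have h := hF (n + 1)
    rw [SModEq.zero, smul_eq_mul, Ideal.mul_top, Ideal.span_singleton_pow,
      Ideal.mem_span_singleton, PowerSeries.X_pow_dvd_iff] at h
    rw [h n n.lt_succ_self, map_zero]
  prec' f hf := by
    refine ⟨PowerSeries.mk fun n => PowerSeries.coeff n (f (n + 1)), fun n => ?_⟩
    rw [SModEq.sub_mem, smul_eq_mul, Ideal.mul_top, Ideal.span_singleton_pow,
      Ideal.mem_span_singleton, PowerSeries.X_pow_dvd_iff]
    intro m hm
    have h := hf (Nat.succ_le_of_lt hm)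
    rw [SModEq.sub_mem, smul_eq_mul, Ideal.mul_top, Ideal.span_singleton_pow,
      Ideal.mem_span_singleton, PowerSeries.X_pow_dvd_iff] at h
    have h' := h m m.lt_succ_self
    rw [map_sub, PowerSeries.coeff_mk]
    rw [map_sub] at h'
    rw [← neg_sub, h', neg_zero]

/-- Hensel's lemma needs a monic polynomial, which `z^a - Q(tz)` generally is not. Multiplying the
equation by `U^(D+a)`, with `U = 1/z` and `D = deg Q`, gives the monic `F(U) = U^N + R(U) - U^D`.
Modulo `t` it is `U^N - U^D`, with the root `1` and derivative `N - D = a ≠ 0` there. -/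
theorem exists_pow_eq_aeval_X_mul [CharZero K] (Q : K[X]) (hQ : Q.coeff 0 = 1) {a : ℕ}
    (ha : a ≠ 0) : ∃ z : PowerSeries K, PowerSeries.constantCoeff z = 1 ∧
      z ^ a = aeval (PowerSeries.X * z) Q := by
  set D := Q.natDegree
  set N := D + a with hN
  set R : (PowerSeries K)[X] := ∑ i ∈ Finset.range D,
    Polynomial.C (PowerSeries.C (Q.coeff (i + 1)) * PowerSeries.X ^ (i + 1)) *
      X ^ (N - (i + 1)) with hR
  set F : (PowerSeries K)[X] := X ^ N + (R - X ^ D) with hF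
  have hmonic : F.Monic := by
    apply monic_X_pow_add
    refine (degree_sub_le _ _).trans_lt (max_lt ?_ ?_)
    · refine (degree_sum_le _ _).trans_lt ((Finset.sup_lt_iff (WithBot.bot_lt_coe N)).2 ?_)
      intro i hi
      refine (degree_C_mul_X_pow_le _ _).trans_lt ?_
      rw [Finset.mem_range] at hi
      exact Nat.cast_lt.2 (by omega : N - (i + 1) < N)
    · rw [degree_X_pow]
      exact_mod_cast (by omega : D < N)
  have := isAdicComplete_span_X (K := K)
  have hR0 : PowerSeries.constantCoeff (R.eval 1) = 0 := by
    simp [hR, eval_finsetSum]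
  have hR1 : PowerSeries.constantCoeff (R.derivative.eval 1) = 0 := by
    simp only [hR, derivative_sum, derivative_C_mul, eval_finsetSum, eval_mul, eval_C]
    simp only [map_sum, map_mul, map_pow, PowerSeries.constantCoeff_X, pow_succ, mul_zero, zero_mul,
      Finset.sum_const_zero]
  obtain ⟨U, hU, hU1⟩ := HenselianRing.is_henselian
    (I := Ideal.span {(PowerSeries.X : PowerSeries K)}) F hmonic 1 (by
      rw [Ideal.mem_span_singleton, PowerSeries.X_dvd_iff]
      simp [hF, hR0]) (by
      apply IsUnit.map
      rw [PowerSeries.isUnit_iff_constantCoeff]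
      have : PowerSeries.constantCoeff (F.derivative.eval 1) = (a : K) := by
        simp [hF, hR1, derivative_X_pow, hN]
      rw [this]
      exact (Nat.cast_ne_zero.2 ha).isUnit)
  rw [Ideal.mem_span_singleton, PowerSeries.X_dvd_iff, map_sub, map_one, sub_eq_zero] at hU1
  have hUU : U * U⁻¹ = 1 := PowerSeries.mul_inv_cancel _ (by simp [hU1])
  refine ⟨U⁻¹, by simp [hU1], ?_⟩
  have hpow : ∀ i ≤ N, U⁻¹ ^ N * U ^ (N - i) = U⁻¹ ^ i := fun i hi => by
    obtain ⟨j, hj⟩ := Nat.exists_eq_add_of_le hi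
    rw [hj, Nat.add_sub_cancel_left, pow_add, mul_assoc, ← mul_pow, mul_comm _ U, hUU, one_pow,
      mul_one]
  have hU' : U ^ D = U ^ N + R.eval U := by
    have h : F.eval U = 0 := hU
    simp only [hF, eval_add, eval_sub, eval_pow, eval_X] at h
    linear_combination -h
  have hUN := hpow 0 (Nat.zero_le N)
  rw [Nat.sub_zero, pow_zero] at hUN
  rw [← hpow a (by omega), show N - a = D by omega, hU', mul_add, hUN, aeval_eq_sum_range,
    Finset.sum_range_succ', hQ, pow_zero, one_smul, add_comm]
  congr 1
  simp only [hR, eval_finsetSum, eval_mul, eval_C, eval_pow, eval_X, Finset.mul_sum]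
  refine Finset.sum_congr rfl fun i hi => ?_
  rw [Finset.mem_range] at hi
  rw [mul_left_comm, hpow (i + 1) (by omega), PowerSeries.smul_eq_C_mul, mul_pow, mul_assoc]

/-- Invariance of the residue under `y = Y(t) = t z`: the left side is the residue of `p(Y) Y' /
Y^(N+1)`. For a monomial of degree `i < N` this is a derivative, up to a nonzero constant, so its
residue vanishes; degree `i > N` gives no pole. -/
theorem coeff_inv_pow_mul_aeval_mul_derivative [CharZero K] {z : PowerSeries K}
    (hz : PowerSeries.constantCoeff z = 1) (p : K[X]) (N : ℕ) :
    PowerSeries.coeff N (z⁻¹ ^ (N + 1) * aeval (PowerSeries.X * z) p *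
      PowerSeries.derivative K (PowerSeries.X * z)) = p.coeff N := by
  have hzz : z⁻¹ * z = 1 := PowerSeries.inv_mul_cancel _ (by simp [hz])
  have hd : PowerSeries.derivative K (PowerSeries.X * z) =
      PowerSeries.X * PowerSeries.derivative K z + z := by
    simp [Derivation.leibniz]
  induction p using Polynomial.induction_on' with
  | add p q hp hq => simp only [map_add, mul_add, add_mul, hp, hq, coeff_add]
  | monomial i c =>
    rw [aeval_monomial, coeff_monomial, PowerSeries.algebraMap_apply, Algebra.algebraMap_self,
      RingHom.id_apply, mul_pow]
    have hrw : z⁻¹ ^ (N + 1) * (PowerSeries.C c * (PowerSeries.X ^ i * z ^ i)) *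
        PowerSeries.derivative K (PowerSeries.X * z) =
        PowerSeries.C c * (PowerSeries.X ^ i * (z⁻¹ ^ (N + 1) * z ^ i *
          PowerSeries.derivative K (PowerSeries.X * z))) := by ring
    rw [hrw, PowerSeries.coeff_C_mul, PowerSeries.coeff_X_pow_mul']
    rcases lt_trichotomy i N with hi | rfl | hi
    · obtain ⟨m, rfl⟩ := Nat.exists_eq_add_of_lt hi
      rw [if_pos hi.le, if_neg hi.ne, show i + m + 1 - i = m + 1 by omega]
      have h1 : z⁻¹ ^ (i + m + 1 + 1) * z ^ i = z⁻¹ ^ (m + 2) := by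
        rw [show i + m + 1 + 1 = (m + 2) + i by ring, pow_add, mul_assoc, ← mul_pow, hzz, one_pow,
          mul_one]
      have h2 : PowerSeries.derivative K (z⁻¹ ^ (m + 1)) =
          PowerSeries.C (-(m + 1 : K)) * (z⁻¹ ^ (m + 2) * PowerSeries.derivative K z) := by
        rw [PowerSeries.derivative_pow, PowerSeries.derivative_inv', Nat.add_sub_cancel]
        simp only [map_neg, map_add, map_one, map_natCast]
        push_cast
        ring
      have h3 : z⁻¹ ^ (m + 2) * (PowerSeries.X * PowerSeries.derivative K z + z) =
          PowerSeries.X * (z⁻¹ ^ (m + 2) * PowerSeries.derivative K z) + z⁻¹ ^ (m + 1) := by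
        linear_combination z⁻¹ ^ (m + 1) * hzz
      rw [h1, hd, h3, map_add, PowerSeries.coeff_succ_X_mul]
      have h4 := congrArg (PowerSeries.coeff m) h2
      rw [PowerSeries.coeff_derivative, PowerSeries.coeff_C_mul] at h4
      have h5 : (m + 1 : K) ≠ 0 := Nat.cast_add_one_ne_zero m
      -- Characteristic zero allows cancelling `m + 1 = N - i`.
      have h6 : (m + 1 : K) * (PowerSeries.coeff m (z⁻¹ ^ (m + 2) * PowerSeries.derivative K z) +
          PowerSeries.coeff (m + 1) (z⁻¹ ^ (m + 1))) = 0 := by linear_combination h4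
      rw [(mul_eq_zero.1 h6).resolve_left h5, mul_zero]
    · rw [if_pos le_rfl, if_pos rfl, Nat.sub_self, PowerSeries.coeff_zero_eq_constantCoeff, hd]
      simp [hz]
    · rw [if_neg (by omega), if_neg hi.ne', mul_zero]

theorem coeff_X_mul_derivative_mul_inv [CharZero K] {z : PowerSeries K}
    (hz : PowerSeries.constantCoeff z = 1) {Q : K[X]} {a : ℕ} (ha : a ≠ 0)
    (hzQ : z ^ a = aeval (PowerSeries.X * z) Q) (n : ℕ) :
    PowerSeries.coeff (a * n) (PowerSeries.X * PowerSeries.derivative K (PowerSeries.X * z) *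
      (1 - PowerSeries.X * z)⁻¹) = ∑ i ∈ Finset.range (a * n), (Q ^ n).coeff i := by
  rcases Nat.eq_zero_or_pos n with rfl | hn
  · simp
  obtain ⟨N, hN⟩ : ∃ N, a * n = N + 1 := ⟨a * n - 1, by have := Nat.mul_pos (by omega : 0 < a) hn; omega⟩
  have hzz : z⁻¹ * z = 1 := PowerSeries.inv_mul_cancel _ (by simp [hz])
  set Y := PowerSeries.X * z with hY
  have hYY : (1 - Y) * (1 - Y)⁻¹ = 1 := PowerSeries.mul_inv_cancel _ (by simp [hY])
  -- Truncating `1/(1 - y)` makes the previous lemma applicable; since `Q(Y)^n = z^(N+1)`, the error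
  -- in `Y'/(1 - Y)` is divisible by `t^(N+1)`.
  set p : K[X] := Q ^ n * ∑ i ∈ Finset.range (N + 1), X ^ i with hp
  have hQn : aeval Y Q ^ n = z ^ (N + 1) := by rw [← hzQ, ← pow_mul, hN]
  have hpY : aeval Y p * (1 - Y) = z ^ (N + 1) * (1 - Y ^ (N + 1)) := by
    have hg := geom_sum_mul_neg Y (N + 1)
    simp only [hp, map_mul, map_pow, map_sum, aeval_X, hQn]
    rw [mul_assoc, hg]
  have hzN : z⁻¹ ^ (N + 1) * z ^ (N + 1) = 1 := by rw [← mul_pow, hzz, one_pow]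
  have hdecomp : PowerSeries.derivative K Y * (1 - Y)⁻¹ =
      z⁻¹ ^ (N + 1) * aeval Y p * PowerSeries.derivative K Y +
        PowerSeries.X ^ (N + 1) * (z ^ (N + 1) * PowerSeries.derivative K Y * (1 - Y)⁻¹) := by
    have h1 : aeval Y p = z ^ (N + 1) * (1 - Y ^ (N + 1)) * (1 - Y)⁻¹ := by
      rw [← hpY, mul_assoc, hYY, mul_one]
    rw [h1, hY, mul_pow]
    linear_combination (-PowerSeries.derivative K (PowerSeries.X * z) *
      (1 - PowerSeries.X * z)⁻¹ * (1 - PowerSeries.X ^ (N + 1) * z ^ (N + 1))) * hzN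
  rw [hN, mul_assoc, PowerSeries.coeff_succ_X_mul, hdecomp, map_add,
    coeff_inv_pow_mul_aeval_mul_derivative hz, PowerSeries.coeff_X_pow_mul', if_neg (by omega),
    add_zero, hp, Finset.mul_sum, finsetSum_coeff]
  simp only [coeff_mul_X_pow']
  rw [← Finset.sum_range_reflect]
  refine Finset.sum_congr rfl fun i hi => ?_
  rw [Finset.mem_range] at hi
  rw [if_pos (by omega)]
  congr 1
  omega

end PowerSeries

end LatticeWalk

/-! ### Residues of rational functions at simple poles -/

namespace LatticeWalk

open Polynomial

theorem eval₂_C_add_yvar {L : Type*} [Field L] (a : L) (p : L[X]) :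
    p.eval₂ (HahnSeries.C : L →+* LaurentSeries L) (HahnSeries.C a + yvar L) =
      HahnSeries.ofPowerSeries ℤ L (taylor a p : L[X]) := by
  induction p using Polynomial.induction_on' with
  | add p q hp hq => rw [eval₂_add, hp, hq, map_add, Polynomial.coe_add, map_add]
  | monomial n c =>
    rw [eval₂_monomial, taylor_monomial, Polynomial.coe_mul, Polynomial.coe_pow,
      Polynomial.coe_add, Polynomial.coe_C, Polynomial.coe_X, Polynomial.coe_C, map_mul, map_pow,
      map_add, HahnSeries.ofPowerSeries_C, HahnSeries.ofPowerSeries_X, HahnSeries.ofPowerSeries_C,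
      add_comm, yvar]

theorem eval₂_C_add_yvar_ne_zero {L : Type*} [Field L] (a : L) {p : L[X]} (hp : p ≠ 0) :
    p.eval₂ (HahnSeries.C : L →+* LaurentSeries L) (HahnSeries.C a + yvar L) ≠ 0 := by
  rw [eval₂_C_add_yvar, map_ne_zero_iff _ HahnSeries.ofPowerSeries_injective, Ne,
    Polynomial.coe_eq_zero_iff, taylor_eq_zero]
  exact hp

/-- `RatFunc.eval` uses the reduced fraction. Any other fraction gives the same value here, because
no nonzero polynomial over `L` vanishes at `a + y`. -/
theorem ratFunc_eval_div {L : Type*} [Field L] (p : L[X]) {q : L[X]} (hq : q ≠ 0) (a : L) :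
    RatFunc.eval (HahnSeries.C : L →+* LaurentSeries L) (HahnSeries.C a + yvar L)
        (algebraMap L[X] (RatFunc L) p / algebraMap L[X] (RatFunc L) q) =
      HahnSeries.ofPowerSeries ℤ L (taylor a p : L[X]) /
        HahnSeries.ofPowerSeries ℤ L (taylor a q : L[X]) := by
  generalize hf : algebraMap L[X] (RatFunc L) p / algebraMap L[X] (RatFunc L) q = f
  have hnum := (RatFunc.num_mul_eq_mul_denom_iff (x := f) (p := p) hq).2 hf.symm
  have hev := congrArg (eval₂ (HahnSeries.C : L →+* LaurentSeries L) (HahnSeries.C a + yvar L)) hnum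
  rw [eval₂_mul, eval₂_mul] at hev
  rw [← eval₂_C_add_yvar, ← eval₂_C_add_yvar]
  exact (div_eq_div_iff (eval₂_C_add_yvar_ne_zero a (RatFunc.denom_ne_zero f))
    (eval₂_C_add_yvar_ne_zero a hq)).2 hev

theorem coeff_ofPowerSeries_div_X_mul {L : Type*} [Field L] (P R : PowerSeries L)
    (hR : PowerSeries.constantCoeff R ≠ 0) :
    (HahnSeries.ofPowerSeries ℤ L P / HahnSeries.ofPowerSeries ℤ L (PowerSeries.X * R)).coeff (-1) =
      PowerSeries.constantCoeff P / PowerSeries.constantCoeff R := by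
  have hRR : R * R⁻¹ = 1 := PowerSeries.mul_inv_cancel _ hR
  have hRR' := congrArg (HahnSeries.ofPowerSeries ℤ L) hRR
  rw [map_mul, map_one] at hRR'
  have hy : (HahnSeries.single 1 1 : LaurentSeries L) * HahnSeries.single (-1) 1 = 1 := by
    rw [HahnSeries.single_mul_single]
    simp
  have hX : (PowerSeries.X * R) ≠ 0 :=
    mul_ne_zero PowerSeries.X_ne_zero (by rintro rfl; simp at hR)
  have hdiv : HahnSeries.ofPowerSeries ℤ L P / HahnSeries.ofPowerSeries ℤ L (PowerSeries.X * R) =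
      HahnSeries.single (-1) 1 * HahnSeries.ofPowerSeries ℤ L (P * R⁻¹) := by
    rw [div_eq_iff ((map_ne_zero_iff _ HahnSeries.ofPowerSeries_injective).2 hX), map_mul, map_mul,
      HahnSeries.ofPowerSeries_X]
    linear_combination (-HahnSeries.ofPowerSeries ℤ L P) * hRR' -
      HahnSeries.ofPowerSeries ℤ L P * HahnSeries.ofPowerSeries ℤ L R *
      HahnSeries.ofPowerSeries ℤ L R⁻¹ * hy
  have hc := HahnSeries.coeff_single_mul_add (r := (1 : L)) (a := (0 : ℤ)) (b := (-1 : ℤ))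
    (x := HahnSeries.ofPowerSeries ℤ L (P * R⁻¹))
  rw [zero_add, one_mul] at hc
  have h0 := HahnSeries.ofPowerSeries_apply_coeff (Γ := ℤ) (P * R⁻¹) 0
  rw [Nat.cast_zero] at h0
  rw [hdiv, hc, h0, PowerSeries.coeff_zero_eq_constantCoeff_apply, map_mul,
    PowerSeries.constantCoeff_inv, div_eq_mul_inv]

theorem constantCoeff_taylor {L : Type*} [Field L] (a : L) (p : L[X]) :
    PowerSeries.constantCoeff ((taylor a p : L[X]) : PowerSeries L) = p.eval a := by
  rw [← PowerSeries.coeff_zero_eq_constantCoeff_apply, Polynomial.coeff_coe, taylor_coeff_zero]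

theorem residue_div {L : Type*} [Field L] (p q : L[X]) (a : L) (hq : q.eval a = 0)
    (hq' : q.derivative.eval a ≠ 0) :
    residue (algebraMap L[X] (RatFunc L) p / algebraMap L[X] (RatFunc L) q) a =
      p.eval a / q.derivative.eval a := by
  have hq0 : q ≠ 0 := by rintro rfl; simp at hq'
  obtain ⟨r, rfl⟩ := dvd_iff_isRoot.2 hq
  have hr : ((X - Polynomial.C a) * r).derivative.eval a = r.eval a := by simp
  have ht : ((taylor a ((X - Polynomial.C a) * r) : L[X]) : PowerSeries L) =
      PowerSeries.X * ((taylor a r : L[X]) : PowerSeries L) := by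
    rw [taylor_mul, map_sub, taylor_X, taylor_C, add_sub_cancel_right, Polynomial.coe_mul,
      Polynomial.coe_X]
  rw [hr] at hq' ⊢
  rw [residue, ratFunc_eval_div p hq0, ht, coeff_ofPowerSeries_div_X_mul, constantCoeff_taylor,
    constantCoeff_taylor]
  rwa [constantCoeff_taylor]

/-! ### Ramified power series inside the Puiseux field -/

section Embedding

variable (K : Type*) [Field K] (a : ℕ) [NeZero a]

/-- The embedding of `K[[t]]` into the field of Puiseux series that sends `t` to `x^(1/a)`. -/
noncomputable def rootEmb : PowerSeries K →+* Puiseux K :=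
  (HahnSeries.embDomainRingHom
    ((AddMonoidHom.mulRight (a : ℚ)⁻¹).comp (Nat.castAddMonoidHom ℚ))
    (fun m n h => by
      have := NeZero.ne a
      simpa [this] using h)
    (fun m n => by
      have : (0 : ℚ) < (a : ℚ)⁻¹ := by
        have := NeZero.pos a
        positivity
      simp [mul_le_mul_iff_left₀ this])).comp HahnSeries.toPowerSeries.symm.toRingHom

variable {K}

theorem coeff_rootEmb_div (F : PowerSeries K) (n : ℕ) :
    (rootEmb K a F).coeff (n * (a : ℚ)⁻¹) = PowerSeries.coeff n F := by
  refine HahnSeries.embDomain_coeff.trans ?_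
  exact HahnSeries.coeff_toPowerSeries_symm

theorem coeff_rootEmb_of_ne (F : PowerSeries K) (q : ℚ) (hq : ∀ n : ℕ, n * (a : ℚ)⁻¹ ≠ q) :
    (rootEmb K a F).coeff q = 0 := by
  refine HahnSeries.embDomain_of_notMem_range ?_
  rintro ⟨n, hn⟩
  exact hq n hn

/-- The hypothesis says `R(t) = F(t^a)`, which is how a series in `x` is recognised. -/
theorem rootEmb_eq_ofPowerSeries (F R : PowerSeries K)
    (h : ∀ m, PowerSeries.coeff m R = if a ∣ m then PowerSeries.coeff (m / a) F else 0) :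
    rootEmb K a R = HahnSeries.ofPowerSeries ℚ K F := by
  have ha : (a : ℚ) ≠ 0 := Nat.cast_ne_zero.2 (NeZero.ne a)
  ext q
  by_cases hq : ∃ n : ℕ, n * (a : ℚ)⁻¹ = q
  · obtain ⟨n, rfl⟩ := hq
    rw [coeff_rootEmb_div, h]
    split_ifs with hn
    · obtain ⟨k, rfl⟩ := hn
      rw [Nat.mul_div_cancel_left _ (NeZero.pos a), Nat.cast_mul, mul_comm (a : ℚ), mul_assoc,
        mul_inv_cancel₀ ha, mul_one, HahnSeries.ofPowerSeries_apply_coeff]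
    · rw [HahnSeries.ofPowerSeries_apply, HahnSeries.embDomain_of_notMem_range]
      rintro ⟨k, hk⟩
      have hk' : (k : ℚ) = n * (a : ℚ)⁻¹ := hk
      rw [eq_mul_inv_iff_mul_eq₀ ha] at hk'
      exact hn ⟨k, by rw [mul_comm]; exact_mod_cast hk'.symm⟩
  · rw [not_exists] at hq
    rw [coeff_rootEmb_of_ne _ _ _ hq, HahnSeries.ofPowerSeries_apply,
      HahnSeries.embDomain_of_notMem_range]
    rintro ⟨k, hk⟩
    have hk' : (k : ℚ) = q := hk
    apply hq (k * a)
    rw [Nat.cast_mul, mul_assoc, mul_inv_cancel₀ ha, mul_one, hk']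

theorem rootEmb_injective : Function.Injective (rootEmb K a) := by
  intro F G h
  ext n
  rw [← coeff_rootEmb_div a F, h, coeff_rootEmb_div]

theorem rootEmb_X_pow : rootEmb K a (PowerSeries.X ^ a) = xvar K := by
  rw [xvar, ← HahnSeries.ofPowerSeries_X]
  apply rootEmb_eq_ofPowerSeries
  intro m
  split_ifs with h
  · obtain ⟨k, rfl⟩ := h
    rw [Nat.mul_div_cancel_left _ (NeZero.pos a), PowerSeries.coeff_X, PowerSeries.coeff_X_pow]
    exact if_congr (by simp [NeZero.ne a]) rfl rfl
  · rw [PowerSeries.coeff_X_pow, if_neg]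
    rintro rfl
    exact h dvd_rfl

theorem orderTop_rootEmb_pos {F : PowerSeries K} (hF : PowerSeries.constantCoeff F = 0) :
    0 < (rootEmb K a F).orderTop := by
  by_contra hlt
  have hne : rootEmb K a F ≠ 0 := by
    intro h0
    simp [h0] at hlt
  obtain ⟨q, hq⟩ := WithTop.ne_top_iff_exists.1 (HahnSeries.orderTop_ne_top.2 hne)
  have hc := HahnSeries.coeff_orderTop_ne hq.symm
  rw [← hq, not_lt] at hlt
  have hq0 : q ≤ 0 := by exact_mod_cast hlt
  apply hc
  by_cases hn : ∃ n : ℕ, n * (a : ℚ)⁻¹ = q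
  · obtain ⟨n, rfl⟩ := hn
    have ha : (0 : ℚ) < (a : ℚ)⁻¹ := by
      have := NeZero.pos a
      positivity
    have hn0 : n = 0 := by
      have : (n : ℚ) ≤ 0 := by
        by_contra h
        exact absurd hq0 (not_le.2 (mul_pos (not_le.1 h) ha))
      exact_mod_cast le_antisymm this (Nat.cast_nonneg n)
    subst hn0
    rw [coeff_rootEmb_div, PowerSeries.coeff_zero_eq_constantCoeff_apply, hF]
  · exact coeff_rootEmb_of_ne _ _ _ (not_exists.1 hn)

/-- Every term of `(g - 1)(y)` has positive valuation, so `g(y)` cannot be `0`. -/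
theorem eval₂_rootEmb_ne_zero {g : (PowerSeries K)[X]}
    (hg : g.map PowerSeries.constantCoeff = 1) {y : Puiseux K} (hy : 0 < y.orderTop) :
    g.eval₂ (rootEmb K a) y ≠ 0 := by
  have hsum : 0 < HahnSeries.addVal ℚ K ((g - 1).eval₂ (rootEmb K a) y) := by
    rw [eval₂_eq_sum_range]
    refine AddValuation.map_lt_sum _ (WithTop.zero_ne_top) fun i _ => ?_
    rw [AddValuation.map_mul, AddValuation.map_pow]
    refine add_pos_of_pos_of_nonneg (orderTop_rootEmb_pos a ?_) (nsmul_nonneg hy.le i)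
    rw [coeff_sub, map_sub, ← coeff_map, hg, sub_eq_zero, coeff_one, coeff_one]
    split_ifs <;> simp
  intro h0
  rw [eval₂_sub, h0, eval₂_one, zero_sub, AddValuation.map_neg, AddValuation.map_one] at hsum
  exact lt_irrefl _ hsum

end Embedding

end LatticeWalk

/-! ### The kernel, its small branches and the residue formula -/

namespace LatticeWalk

open Polynomial

/-- The polynomial `y^{u⁻} Γ(y)`. -/
noncomputable def shiftedGam (S : Finset ℤ) : ℤ[X] := ∑ u ∈ S, X ^ (u + (uMinus S : ℤ)).toNat

theorem add_uMinus_nonneg {S : Finset ℤ} {u : ℤ} (hu : u ∈ S) : 0 ≤ u + uMinus S := by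
  have h : (-u).toNat ≤ uMinus S := Finset.le_sup (f := fun u : ℤ => (-u).toNat) hu
  omega

theorem Gam_eq (S : Finset ℤ) :
    Gam S = LaurentPolynomial.T (-(uMinus S : ℤ)) * toLaurent (shiftedGam S) := by
  rw [Gam, shiftedGam, map_sum, Finset.mul_sum]
  refine Finset.sum_congr rfl fun u hu => ?_
  rw [toLaurent_X_pow, ← LaurentPolynomial.T_add, Int.toNat_of_nonneg (add_uMinus_nonneg hu)]
  congr 1
  ring

theorem coeff_zero_shiftedGam {S : Finset ℤ} (hS : uMinus S ≠ 0) : (shiftedGam S).coeff 0 = 1 := by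
  have hne : S.Nonempty := by
    rw [Finset.nonempty_iff_ne_empty]
    rintro rfl
    simp [uMinus] at hS
  obtain ⟨v, hv, hv'⟩ := Finset.exists_mem_eq_sup S hne fun u : ℤ => (-u).toNat
  have hva : uMinus S = (-v).toNat := hv'
  rw [shiftedGam, finsetSum_coeff, Finset.sum_eq_single_of_mem v hv]
  · rw [show (v + (uMinus S : ℤ)).toNat = 0 by omega]
    simp
  · intro u hu huv
    rw [coeff_X_pow, if_neg]
    have := add_uMinus_nonneg hu
    omega

theorem coeff_A_eq_sum (S : Finset ℤ) (n : ℕ) :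
    PowerSeries.coeff n (A S) =
      ∑ i ∈ Finset.range (uMinus S * n), ((shiftedGam S ^ n).coeff i : ℚ) := by
  rw [coeff_A, Gam_eq, mul_pow, LaurentPolynomial.T_pow, ← map_pow,
    ← negSum_T_neg_mul_toLaurent, Nat.cast_mul, mul_neg, mul_comm (n : ℤ)]

section Roots

variable {K : Type*} [Field K]

/-- The kernel `y^a - t^a Q(y)` over the ring of power series in `t`. -/
noncomputable def ramifiedKernel (a : ℕ) (Q : K[X]) : (PowerSeries K)[X] :=
  X ^ a - Polynomial.C (PowerSeries.X ^ a) * Q.map (PowerSeries.C (R := K))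

theorem eval_ramifiedKernel (a : ℕ) (Q : K[X]) (Y : PowerSeries K) :
    (ramifiedKernel a Q).eval Y = Y ^ a - PowerSeries.X ^ a * aeval Y Q := by
  rw [ramifiedKernel, eval_sub, eval_pow, eval_X, eval_mul, eval_C, eval_map]
  rfl

theorem eval_derivative_ramifiedKernel (a : ℕ) (Q : K[X]) (Y : PowerSeries K) :
    (ramifiedKernel a Q).derivative.eval Y =
      (a : PowerSeries K) * Y ^ (a - 1) - PowerSeries.X ^ a * aeval Y Q.derivative := by
  rw [ramifiedKernel, derivative_sub, derivative_X_pow, derivative_C_mul, eval_sub, eval_mul,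
    eval_pow, eval_X, eval_C, eval_mul, eval_C, Polynomial.derivative_map, eval_map]
  rfl

/-- Differentiate `Y^a = t^a Q(Y)`, multiply by `t`, and replace `t^a Q(Y)` by `Y^a`. This removes
the derivative of the kernel from the residue, and also shows that nonzero roots are simple. -/
theorem natCast_mul_pow_eq {a : ℕ} (ha : a ≠ 0) (Q : K[X]) {Y : PowerSeries K}
    (hY : (ramifiedKernel a Q).eval Y = 0) :
    (a : PowerSeries K) * Y ^ a = (ramifiedKernel a Q).derivative.eval Y *
      (PowerSeries.X * PowerSeries.derivative K Y) := by
  rw [eval_derivative_ramifiedKernel]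
  rw [eval_ramifiedKernel, sub_eq_zero] at hY
  have hd := congrArg (PowerSeries.derivative K) hY
  rw [PowerSeries.derivative_pow, Derivation.leibniz, Derivation.map_aeval,
    PowerSeries.derivative_pow, PowerSeries.derivative_X] at hd
  simp only [smul_eq_mul, mul_one] at hd
  obtain ⟨b, rfl⟩ := Nat.exists_eq_succ_of_ne_zero ha
  simp only [Nat.succ_eq_add_one, Nat.add_sub_cancel] at hd hY ⊢
  linear_combination ((b + 1 : ℕ) : PowerSeries K) * hY - PowerSeries.X * hd

theorem eval_ramifiedKernel_rescale {a : ℕ} (Q : K[X]) {Y : PowerSeries K}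
    (hY : (ramifiedKernel a Q).eval Y = 0) {ω : K} (hω : ω ^ a = 1) :
    (ramifiedKernel a Q).eval (PowerSeries.rescale ω Y) = 0 := by
  have h := congrArg (PowerSeries.rescale ω) hY
  rw [eval_ramifiedKernel, map_sub, map_mul, map_pow, map_pow, PowerSeries.rescale_X, mul_pow,
    ← map_pow PowerSeries.C, hω, map_one, one_mul, map_zero, aeval_def, hom_eval₂] at h
  rw [eval_ramifiedKernel, aeval_def, ← h]
  congr 3
  ext1 c
  ext n
  rw [RingHom.comp_apply, PowerSeries.coeff_rescale, PowerSeries.algebraMap_apply,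
    Algebra.algebraMap_self, RingHom.id_apply, PowerSeries.coeff_C]
  split_ifs with hn
  · rw [hn, pow_zero, one_mul]
  · rw [mul_zero]

theorem X_mul_derivative_rescale (ω : K) (F : PowerSeries K) :
    PowerSeries.X * PowerSeries.derivative K (PowerSeries.rescale ω F) =
      PowerSeries.rescale ω (PowerSeries.X * PowerSeries.derivative K F) := by
  ext n
  rw [PowerSeries.coeff_rescale]
  cases n with
  | zero => simp
  | succ n =>
    rw [PowerSeries.coeff_succ_X_mul, PowerSeries.coeff_succ_X_mul, PowerSeries.coeff_derivative,
      PowerSeries.coeff_derivative, PowerSeries.coeff_rescale, mul_assoc]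

theorem rescale_inv (ω : K) {F : PowerSeries K} (hF : PowerSeries.constantCoeff F ≠ 0) :
    PowerSeries.rescale ω F⁻¹ = (PowerSeries.rescale ω F)⁻¹ := by
  have h0 : PowerSeries.constantCoeff (PowerSeries.rescale ω F) ≠ 0 := by
    rw [← PowerSeries.coeff_zero_eq_constantCoeff_apply, PowerSeries.coeff_rescale, pow_zero,
      one_mul, PowerSeries.coeff_zero_eq_constantCoeff_apply]
    exact hF
  rw [PowerSeries.eq_inv_iff_mul_eq_one h0, ← map_mul, PowerSeries.inv_mul_cancel _ hF, map_one]

/-- The product of the `y - Y_j` divides the kernel, and both reduce to `y^a` modulo `t`. The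
cofactor therefore reduces to `1` and has no root of positive valuation. -/
theorem exists_eq_of_eval₂_ramifiedKernel {a : ℕ} [NeZero a] (Q : K[X])
    (Y : ℕ → PowerSeries K) (hinj : Set.InjOn Y (Finset.range a))
    (hY0 : ∀ j < a, PowerSeries.constantCoeff (Y j) = 0)
    (hY : ∀ j < a, (ramifiedKernel a Q).eval (Y j) = 0) {y : Puiseux K} (hy : 0 < y.orderTop)
    (h : (ramifiedKernel a Q).eval₂ (rootEmb K a) y = 0) : ∃ j < a, rootEmb K a (Y j) = y := by
  have hred : (ramifiedKernel a Q).map PowerSeries.constantCoeff = X ^ a := by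
    simp [ramifiedKernel, NeZero.ne a]
  have hf0 : ramifiedKernel a Q ≠ 0 := by
    intro h0
    rw [h0, Polynomial.map_zero] at hred
    exact pow_ne_zero a X_ne_zero hred.symm
  have hdvd : (((Finset.range a).val.map Y).map fun b => X - Polynomial.C b).prod ∣
      ramifiedKernel a Q := by
    rw [Multiset.prod_X_sub_C_dvd_iff_le_roots hf0,
      Multiset.le_iff_subset ((Finset.range a).nodup.map_on fun i hi j hj hij => hinj hi hj hij)]
    intro b hb
    obtain ⟨j, hj, rfl⟩ := Multiset.mem_map.1 hb
    rw [mem_roots hf0]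
    exact hY j (Finset.mem_range.1 hj)
  obtain ⟨g, hg⟩ := hdvd
  rw [Multiset.map_map] at hg
  change _ = (∏ j ∈ Finset.range a, (X - Polynomial.C (Y j))) * g at hg
  have hg1 : g.map PowerSeries.constantCoeff = 1 := by
    have h1 := congrArg (Polynomial.map PowerSeries.constantCoeff) hg
    rw [hred, Polynomial.map_mul, Polynomial.map_prod, Finset.prod_congr rfl (g := fun _ => X),
      Finset.prod_const, Finset.card_range] at h1
    · exact (mul_eq_left₀ (pow_ne_zero a X_ne_zero)).1 h1.symm
    · intro j hj
      simp [hY0 j (Finset.mem_range.1 hj)]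
  rw [hg, eval₂_mul, eval₂_finsetProd] at h
  obtain ⟨j, hj, hj'⟩ := Finset.prod_eq_zero_iff.1
    ((mul_eq_zero.1 h).resolve_right (eval₂_rootEmb_ne_zero a hg1 hy))
  rw [eval₂_sub, eval₂_X, eval₂_C, sub_eq_zero] at hj'
  exact ⟨j, Finset.mem_range.1 hj, hj'.symm⟩

theorem kernelPoly_eq (S : Finset ℤ) [NeZero (uMinus S)] :
    kernelPoly K S = (ramifiedKernel (uMinus S) ((shiftedGam S).map (Int.castRingHom K))).map
      (rootEmb K (uMinus S)) := by
  simp only [kernelPoly, ramifiedKernel, Polynomial.map_sub, Polynomial.map_pow, map_X,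
    Polynomial.map_mul, map_C, rootEmb_X_pow, shiftedGam, Polynomial.map_sum]

theorem ratFun_eq (S : Finset ℤ) :
    ratFun K S = algebraMap (Puiseux K)[X] (RatFunc (Puiseux K)) (X ^ uMinus S) /
      algebraMap (Puiseux K)[X] (RatFunc (Puiseux K)) ((1 - X) * kernelPoly K S) := by
  have hX : (RatFunc.X : RatFunc (Puiseux K)) ≠ 0 := RatFunc.X_ne_zero
  have hker : algebraMap (Puiseux K)[X] (RatFunc (Puiseux K)) (kernelPoly K S) =
      RatFunc.X ^ uMinus S * (1 - RatFunc.C (xvar K) *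
        evalAt (RatFunc.X : RatFunc (Puiseux K)) RatFunc.X_ne_zero (Gam S)) := by
    have h1 : RatFunc.X ^ uMinus S *
        evalAt (RatFunc.X : RatFunc (Puiseux K)) RatFunc.X_ne_zero (Gam S) =
        ∑ u ∈ S, RatFunc.X ^ (u + (uMinus S : ℤ)).toNat := by
      rw [Gam, map_sum, Finset.mul_sum]
      refine Finset.sum_congr rfl fun u hu => ?_
      rw [evalAt_T, ← zpow_natCast, ← zpow_natCast, Int.toNat_of_nonneg (add_uMinus_nonneg hu),
        ← zpow_add₀ hX, add_comm]
    rw [kernelPoly]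
    simp only [map_sub, map_mul, map_sum, map_pow, RatFunc.algebraMap_X, RatFunc.algebraMap_C]
    rw [← h1]
    ring
  rw [ratFun, map_mul, hker, map_sub, map_one, map_pow, RatFunc.algebraMap_X, mul_left_comm,
    ← div_div (RatFunc.X ^ uMinus S), div_self (pow_ne_zero _ hX)]

theorem residue_ratFun (S : Finset ℤ) {y : Puiseux K} (hy : 0 < y.orderTop)
    (hroot : (kernelPoly K S).eval y = 0) (hsimple : (kernelPoly K S).derivative.eval y ≠ 0) :
    residue (ratFun K S) y =
      y ^ uMinus S / ((1 - y) * (kernelPoly K S).derivative.eval y) := by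
  have h1 : 1 - y ≠ 0 := by
    intro h
    rw [sub_eq_zero] at h
    rw [← h, HahnSeries.orderTop_one] at hy
    exact lt_irrefl _ hy
  have hd : ((1 - X) * kernelPoly K S).derivative.eval y =
      (1 - y) * (kernelPoly K S).derivative.eval y := by
    simp [hroot]
  rw [ratFun_eq, residue_div, hd, eval_pow, eval_X]
  · rw [eval_mul, hroot, mul_zero]
  · rw [hd]
    exact mul_ne_zero h1 hsimple

theorem residue_ratFun_rootEmb [CharZero K] (S : Finset ℤ) [NeZero (uMinus S)]
    {Y : PowerSeries K} (hY0 : PowerSeries.constantCoeff Y = 0) (hYne : Y ≠ 0)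
    (hY : (ramifiedKernel (uMinus S) ((shiftedGam S).map (Int.castRingHom K))).eval Y = 0) :
    residue (ratFun K S) (rootEmb K (uMinus S) Y) = rootEmb K (uMinus S)
      (PowerSeries.C (uMinus S : K)⁻¹ *
        (PowerSeries.X * PowerSeries.derivative K Y * (1 - Y)⁻¹)) := by
  have ha : (uMinus S : K) ≠ 0 := Nat.cast_ne_zero.2 (NeZero.ne _)
  have hmain := natCast_mul_pow_eq (NeZero.ne (uMinus S)) _ hY
  set f := ramifiedKernel (uMinus S) ((shiftedGam S).map (Int.castRingHom K))
  have hC : PowerSeries.C (uMinus S : K)⁻¹ * (uMinus S : PowerSeries K) = 1 := by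
    rw [← map_natCast (PowerSeries.C (R := K)), ← map_mul, inv_mul_cancel₀ ha, map_one]
  have hf' : f.derivative.eval Y ≠ 0 := by
    intro h0
    rw [h0, zero_mul] at hmain
    refine (mul_ne_zero (right_ne_zero_of_mul (hC.trans_ne one_ne_zero))
      (pow_ne_zero _ hYne)) hmain
  have hev : (kernelPoly K S).eval (rootEmb K (uMinus S) Y) = 0 := by
    rw [kernelPoly_eq, eval_map_apply, hY, map_zero]
  have hev' : (kernelPoly K S).derivative.eval (rootEmb K (uMinus S) Y) =
      rootEmb K (uMinus S) (f.derivative.eval Y) := by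
    rw [kernelPoly_eq, Polynomial.derivative_map, eval_map_apply]
  have hne : rootEmb K (uMinus S) (f.derivative.eval Y) ≠ 0 :=
    (map_ne_zero_iff _ (rootEmb_injective _)).2 hf'
  have h1Y : (1 - Y)⁻¹ * (1 - Y) = 1 := PowerSeries.inv_mul_cancel _ (by simp [hY0])
  have h1Yne : rootEmb K (uMinus S) (1 - Y) ≠ 0 :=
    (map_ne_zero_iff _ (rootEmb_injective _)).2 (right_ne_zero_of_mul (h1Y.trans_ne one_ne_zero))
  rw [residue_ratFun S (orderTop_rootEmb_pos _ hY0) hev (by rwa [hev']), hev',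
    ← map_one (rootEmb K (uMinus S)), ← map_sub, ← map_mul, ← map_pow, div_eq_iff, ← map_mul]
  · congr 1
    linear_combination (-Y ^ uMinus S) * hC + PowerSeries.C (uMinus S : K)⁻¹ * hmain -
      PowerSeries.C (uMinus S : K)⁻¹ * PowerSeries.X * PowerSeries.derivative K Y *
        f.derivative.eval Y * h1Y
  · rw [map_mul]
    exact mul_ne_zero h1Yne hne

/-- Orthogonality of the `a`-th roots of unity. -/
theorem coeff_sum_rescale [CharZero K] {a : ℕ} (ha : a ≠ 0) {ζ : K} (hζ : IsPrimitiveRoot ζ a)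
    (B : PowerSeries K) (m : ℕ) :
    PowerSeries.coeff m (∑ j ∈ Finset.range a,
      PowerSeries.C (a : K)⁻¹ * PowerSeries.rescale (ζ ^ j) B) =
      if a ∣ m then PowerSeries.coeff m B else 0 := by
  have ha' : (a : K) ≠ 0 := Nat.cast_ne_zero.2 ha
  simp only [map_sum, PowerSeries.coeff_C_mul, PowerSeries.coeff_rescale]
  rw [← Finset.mul_sum, ← Finset.sum_mul]
  split_ifs with h
  · have h1 : ∀ j ∈ Finset.range a, (ζ ^ j) ^ m = 1 := fun j _ => by
      rw [pow_right_comm, (hζ.pow_eq_one_iff_dvd m).2 h, one_pow]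
    rw [Finset.sum_congr rfl h1, Finset.sum_const, Finset.card_range, nsmul_eq_mul, mul_one,
      ← mul_assoc, inv_mul_cancel₀ ha', one_mul]
  · have h1 : ζ ^ m - 1 ≠ 0 := by
      rw [sub_ne_zero]
      exact fun h' => h ((hζ.pow_eq_one_iff_dvd m).1 h')
    have h2 : (∑ j ∈ Finset.range a, (ζ ^ j) ^ m) = 0 := by
      have hg := geom_sum_mul (ζ ^ m) a
      rw [pow_right_comm, hζ.pow_eq_one, one_pow, sub_self] at hg
      rw [← (mul_eq_zero.1 hg).resolve_right h1]
      exact Finset.sum_congr rfl fun j _ => pow_right_comm _ _ _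
    rw [h2, zero_mul, mul_zero]

theorem mem_smallBranches (S : Finset ℤ) (h0 : kernelPoly K S ≠ 0) (y : Puiseux K) :
    y ∈ smallBranches K S ↔ (kernelPoly K S).eval y = 0 ∧ 0 < y.orderTop := by
  classical
  rw [smallBranches, Finset.mem_filter, Multiset.mem_toFinset, mem_roots h0, IsRoot.def]

/-- Here `Γ` is a polynomial, so `xΓ(y)` has positive valuation and cannot equal `1`. -/
theorem smallBranches_eq_empty (S : Finset ℤ) (hS : uMinus S = 0) : smallBranches K S = ∅ := by
  rw [Finset.eq_empty_iff_forall_notMem]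
  intro y hy
  classical
  rw [smallBranches, Finset.mem_filter, Multiset.mem_toFinset] at hy
  obtain ⟨hroot, hy⟩ := hy
  have h := (mem_roots'.1 hroot).2
  rw [IsRoot.def, kernelPoly, hS, pow_zero, eval_sub, eval_one, eval_mul, eval_C, eval_finsetSum,
    sub_eq_zero] at h
  have hx : 0 < HahnSeries.addVal ℚ K (xvar K) := by
    rw [HahnSeries.addVal_apply, xvar, HahnSeries.orderTop_single one_ne_zero]
    exact_mod_cast one_pos
  have hsum : 0 ≤ HahnSeries.addVal ℚ K
      (∑ u ∈ S, eval y (X ^ (u + ((0 : ℕ) : ℤ)).toNat)) := by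
    refine AddValuation.map_le_sum _ fun u _ => ?_
    rw [eval_pow, eval_X, AddValuation.map_pow]
    exact nsmul_nonneg hy.le _
  have h1 := congrArg (HahnSeries.addVal ℚ K) h
  rw [AddValuation.map_one, AddValuation.map_mul] at h1
  exact absurd h1 (add_pos_of_pos_of_nonneg hx hsum).ne

theorem toPuiseux_A_eq [CharZero K] [IsAlgClosed K] (S : Finset ℤ) :
    toPuiseux K (A S) = ∑ y ∈ smallBranches K S, residue (ratFun K S) y := by
  classical
  rcases eq_or_ne (uMinus S) 0 with hS | hS
  · have hA : A S = 0 := by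
      ext n
      rw [coeff_A_eq_sum, hS, zero_mul, Finset.sum_range_zero, map_zero]
    rw [smallBranches_eq_empty S hS, hA, map_zero, Finset.sum_empty]
  have : NeZero (uMinus S) := ⟨hS⟩
  set a := uMinus S
  set Q : K[X] := (shiftedGam S).map (Int.castRingHom K) with hQ
  have hQ0 : Q.coeff 0 = 1 := by
    rw [hQ, coeff_map, coeff_zero_shiftedGam hS, map_one]
  obtain ⟨z, hz, hzQ⟩ := exists_pow_eq_aeval_X_mul Q hQ0 hS
  obtain ⟨ζ, hζ⟩ := HasEnoughRootsOfUnity.exists_primitiveRoot K a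
  set Y : PowerSeries K := PowerSeries.X * z with hYdef
  have hY0 : PowerSeries.constantCoeff Y = 0 := by simp [hYdef]
  have hY : (ramifiedKernel a Q).eval Y = 0 := by
    rw [eval_ramifiedKernel, ← hzQ, hYdef, mul_pow, sub_self]
  have hζj : ∀ j, (ζ ^ j) ^ a = 1 := fun j => by rw [pow_right_comm, hζ.pow_eq_one, one_pow]
  have hYj0 : ∀ j, PowerSeries.constantCoeff (PowerSeries.rescale (ζ ^ j) Y) = 0 := fun j => by
    rw [← PowerSeries.coeff_zero_eq_constantCoeff_apply, PowerSeries.coeff_rescale, pow_zero,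
      one_mul, PowerSeries.coeff_zero_eq_constantCoeff_apply, hY0]
  have hYj1 : ∀ j, PowerSeries.coeff 1 (PowerSeries.rescale (ζ ^ j) Y) = ζ ^ j := fun j => by
    rw [PowerSeries.coeff_rescale, pow_one, hYdef, ← zero_add 1, PowerSeries.coeff_succ_X_mul,
      PowerSeries.coeff_zero_eq_constantCoeff_apply, hz, mul_one]
  have hYj : ∀ j, (ramifiedKernel a Q).eval (PowerSeries.rescale (ζ ^ j) Y) = 0 := fun j =>
    eval_ramifiedKernel_rescale Q hY (hζj j)
  have hYjne : ∀ j, PowerSeries.rescale (ζ ^ j) Y ≠ 0 := fun j h0 => by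
    have h := hYj1 j
    rw [h0, map_zero] at h
    exact pow_ne_zero j (hζ.ne_zero hS) h.symm
  have hinj : Set.InjOn (fun j => PowerSeries.rescale (ζ ^ j) Y) (Finset.range a) := by
    intro i hi j hj hij
    have h := congrArg (PowerSeries.coeff 1) hij
    simp only [hYj1] at h
    exact hζ.pow_inj (Finset.mem_range.1 hi) (Finset.mem_range.1 hj) h
  have hker0 : kernelPoly K S ≠ 0 := by
    intro h0
    have h := congrArg (Polynomial.eval (0 : Puiseux K)) h0
    -- The kernel takes the value `-x` at `y = 0`; its being nonzero matters because
    -- `Polynomial.roots` of `0` is empty.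
    have hc : (ramifiedKernel a Q).eval 0 = -PowerSeries.X ^ a := by
      rw [eval_ramifiedKernel, zero_pow hS, aeval_def, eval₂_at_zero, hQ0, map_one, mul_one, zero_sub]
    rw [kernelPoly_eq, ← map_zero (rootEmb K a), eval_map_apply, hc, eval_zero, map_neg, neg_eq_zero,
      rootEmb_X_pow] at h
    exact HahnSeries.single_ne_zero one_ne_zero h
  have hbranches : smallBranches K S =
      (Finset.range a).image fun j => rootEmb K a (PowerSeries.rescale (ζ ^ j) Y) := by
    ext y
    rw [mem_smallBranches S hker0, Finset.mem_image, kernelPoly_eq]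
    constructor
    · rintro ⟨hroot, hy⟩
      rw [eval_map] at hroot
      obtain ⟨j, hj, rfl⟩ := exists_eq_of_eval₂_ramifiedKernel Q _ hinj (fun j _ => hYj0 j)
        (fun j _ => hYj j) hy hroot
      exact ⟨j, Finset.mem_range.2 hj, rfl⟩
    · rintro ⟨j, -, rfl⟩
      refine ⟨?_, orderTop_rootEmb_pos a (hYj0 j)⟩
      rw [eval_map_apply, hYj, map_zero]
  rw [hbranches, Finset.sum_image fun i hi j hj hij => hinj hi hj (rootEmb_injective a hij)]
  have hres : ∀ j ∈ Finset.range a,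
      residue (ratFun K S) (rootEmb K a (PowerSeries.rescale (ζ ^ j) Y)) =
        rootEmb K a (PowerSeries.C (a : K)⁻¹ * PowerSeries.rescale (ζ ^ j)
          (PowerSeries.X * PowerSeries.derivative K Y * (1 - Y)⁻¹)) := fun j _ => by
    rw [residue_ratFun_rootEmb S (hYj0 j) (hYjne j) (hYj j), X_mul_derivative_rescale,
      map_mul (PowerSeries.rescale (ζ ^ j)) _ (1 - Y)⁻¹, rescale_inv _ (by simp [hY0]), map_sub,
      map_one]
  rw [Finset.sum_congr rfl hres, ← map_sum]
  -- The sum over conjugates is a series in `t^a = x`, compared with `A` coefficient by coefficient.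
  refine (rootEmb_eq_ofPowerSeries a (PowerSeries.map (algebraMap ℚ K) (A S)) _ fun m => ?_).symm
  rw [coeff_sum_rescale hS hζ]
  split_ifs with hm
  · obtain ⟨n, rfl⟩ := hm
    rw [Nat.mul_div_cancel_left _ (NeZero.pos a), coeff_X_mul_derivative_mul_inv hz hS hzQ,
      PowerSeries.coeff_map, coeff_A_eq_sum, map_sum]
    refine Finset.sum_congr rfl fun i _ => ?_
    rw [hQ, ← Polynomial.map_pow, coeff_map, map_intCast, eq_intCast]
  · rfl

end Roots

end LatticeWalk

theorem mainTheorem9 (K : Type*) [Field K] [CharZero K] [IsAlgClosed K] (S : Finset ℤ) :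
    -- `A(x)` has no constant term, so that `A(x)/x` is a power series
    PowerSeries.constantCoeff (LatticeWalk.A S) = 0 ∧
    -- `M(x) = exp(-∫ A(x)/x dx) / (1 - x Γ(1))`
    LatticeWalk.M S =
      LatticeWalk.expOf (-LatticeWalk.integral (LatticeWalk.divX (LatticeWalk.A S))) *
        (1 - PowerSeries.X *
          PowerSeries.C (LatticeWalk.evalAt (1 : ℚ) one_ne_zero (LatticeWalk.Gam S)))⁻¹ ∧
    -- `log M(x) = -log(1 - x Γ(1)) - ∫ A(x)/x dx`
    PowerSeries.logOf (LatticeWalk.M S) =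
      -PowerSeries.logOf (1 - PowerSeries.X *
          PowerSeries.C (LatticeWalk.evalAt (1 : ℚ) one_ne_zero (LatticeWalk.Gam S))) -
        LatticeWalk.integral (LatticeWalk.divX (LatticeWalk.A S)) ∧
    -- `A(x)` is the sum of the residues of `1 / ((1 - y)(1 - x Γ(y)))` at the small branches
    LatticeWalk.toPuiseux K (LatticeWalk.A S) =
      ∑ y ∈ LatticeWalk.smallBranches K S, LatticeWalk.residue (LatticeWalk.ratFun K S) y := by
  exact ⟨LatticeWalk.constantCoeff_A S, LatticeWalk.M_eq_expOf S, LatticeWalk.logOf_M S,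
    LatticeWalk.toPuiseux_A_eq S⟩
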